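/- Let $\nu,\mu\in\mathbb{R}$ with $\mu+\nu>-1$ and $\mu-\nu\in\mathbb{N}_0$. Let $J_\nu$ be the Bessel function of the first kind and $K_\nu$ the modified Bessel function of the second kind, and for $x>0$ put \[ w_{\mu,\nu}(x)=\tfrac12 K_\nu(\sqrt{x})\,x^{(\mu-1)/2}\ \text{ if }\mu-\nu\text{ is even},\qquad w_{\mu,\nu}(x)=\tfrac12 K_\nu(\sqrt{x})\,x^{\mu/2}\ \text{ if }\mu-\nu\text{ is odd}. \] There is a unique sequence $(\phi_n)_{n\ge 0}$ of monic real polynomials with $\deg\phi_n=n$ and $\int_0^\infty w_{\mu,\nu}(x)\phi_n(x)\phi_m(x)\,dx=0$ for all $n\neq m$. For $N\ge 0$ let $P_N^{(\mu,\nu)}$ denote a monic polynomial (with complex coefficients) of degree $N$ such that \[ \int_0^\infty P_N^{(\mu,\nu)}(x)\,x^{k+\mu}J_\nu(x)\,dx=0,\qquad k=0,\dots,N-1, \] where the improper integrals are Abel limits, $\int_0^\infty f(x)\,dx:=\lim_{s\to0^+}\int_0^\infty f(x)e^{-sx}\,dx$. Then for every $n\ge 0$: 1. $P_{2n}^{(\mu,\nu)}$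 exists, is unique, and $P_{2n}^{(\mu,\nu)}(x)=(-1)^n\phi_n(-x^2)$. 2. If $\mu-\nu$ is even, then $\phi_n(0)\neq0$, $P_{2n+1}^{(\mu,\nu)}$ exists, is unique, and \[ P_{2n+1}^{(\mu,\nu)}(x)=\frac{(-1)^{n+1}}{x}\left(\phi_{n+1}(-x^2)-\frac{\phi_{n+1}(0)}{\phi_n(0)}\,\phi_n(-x^2)\right)\qquad(x\neq0). \] 3. If $\mu-\nu$ is odd, then $P_{2n+1}^{(\mu,\nu)}$ does not exist. -/

import Mathlib

open MeasureTheory Filter Topology Polynomial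

noncomputable section

/-- The Bessel function of the first kind `J_ν(x)` of real order `ν` at a real point `x > 0`,
by its power series. `Real.Gamma` vanishes at the poles of the Gamma function, so that the terms
with `ν + k + 1 ∈ {0, -1, -2, …}` are zero, in accordance with the convention `1 / Γ = 0` there. -/
def besselJ (ν x : ℝ) : ℝ :=
  ∑' k : ℕ, (-1) ^ k / ((k.factorial : ℝ) * Real.Gamma (ν + k + 1)) * (x / 2) ^ (2 * (k : ℝ) + ν)

/-- The modified Bessel function of the second kind `K_ν(x)` of real order `ν` at a real point
`x > 0`: `K_ν(x) = ∫_0^∞ e^{-x cosh t} cosh (ν t) dt`. -/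
def besselK (ν x : ℝ) : ℝ :=
  ∫ t in Set.Ioi (0 : ℝ), Real.exp (-x * Real.cosh t) * Real.cosh (ν * t)

open Classical in
/-- The weight function `w_{μ,ν}` on `(0, ∞)`, for `μ - ν ∈ ℕ₀`: it is
`x^{(μ-1)/2} K_ν(√x) / 2` if `μ - ν` is even and `x^{μ/2} K_ν(√x) / 2` if `μ - ν` is odd. -/
def prudnikovWeight (μ ν x : ℝ) : ℝ :=
  besselK ν (Real.sqrt x) / 2 *
    (if ∃ j : ℕ, μ - ν = 2 * (j : ℝ) then x ^ ((μ - 1) / 2) else x ^ (μ / 2))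

/-- `φ` is the sequence of monic polynomials, `φ n` of degree `n`, that are orthogonal with respect
to the weight `w` on `(0, ∞)`. -/
structure IsMonicOrthogonalSeq (w : ℝ → ℝ) (φ : ℕ → ℝ[X]) : Prop where
  monic : ∀ n, (φ n).Monic
  natDegree_eq : ∀ n, (φ n).natDegree = n
  integrable : ∀ n m,
    IntegrableOn (fun x => w x * (φ n).eval x * (φ m).eval x) (Set.Ioi 0)
  orthogonal : ∀ n m, n ≠ m →
    ∫ x in Set.Ioi (0 : ℝ), w x * (φ n).eval x * (φ m).eval x = 0

/-- The improper integral `∫_0^∞ f(x) dx` exists in the sense of Abel and has the value `L`: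
`lim_{s → 0+} ∫_0^∞ f(x) e^{-s x} dx = L`, the integrals for `s > 0` being convergent. -/
def HasAbelIntegral (f : ℝ → ℂ) (L : ℂ) : Prop :=
  (∀ s : ℝ, 0 < s → IntegrableOn (fun x => f x * (Real.exp (-s * x) : ℂ)) (Set.Ioi 0)) ∧
    Tendsto (fun s : ℝ => ∫ x in Set.Ioi (0 : ℝ), f x * (Real.exp (-s * x) : ℂ))
      (𝓝[>] 0) (𝓝 L)

/-- `P` is a monic polynomial of degree `N` that is orthogonal (in the sense of Abel) with respect
to `x^μ J_ν(x)` on `(0, ∞)`: `∫_0^∞ P(x) x^{k+μ} J_ν(x) dx = 0` for `k = 0, …, N - 1`. -/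
structure IsBesselOrthogonal (μ ν : ℝ) (N : ℕ) (P : ℂ[X]) : Prop where
  monic : P.Monic
  natDegree_eq : P.natDegree = N
  orthogonal : ∀ k < N,
    HasAbelIntegral (fun x => P.eval (x : ℂ) * ((x ^ ((k : ℝ) + μ) * besselJ ν x : ℝ) : ℂ)) 0

end

/-! Everything reduces to a comparison of moments. Put m = μ - ν and r = m mod 2. Two recurrences
for the Laplace transform of x^b J_ν, obtained by integration by parts, show as s → 0+ that the Abel
moments of J_ν obey a two-step recurrence and that those with exponent ν + odd vanish
(`besselAbelMoment_add_two`, `exists_tendsto_besselLaplace`). After the substitution x ↦ x² the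
moments of the weight are Mellin integrals of K_ν, and these obey the same recurrence up to sign
(`integral_rpow_mul_besselK_add_two`). Hence the Bessel moment of index 2i + r is c (-1)^i times the
i-th moment of the weight, with c ≠ 0 (`besselAbelMoment_eq_prudnikovMoment`).

Let L be integration against the weight and B the Bessel functional. For m even, B(p(-X²)) = c L(p)
and B kills odd polynomials; for m odd, B(X p(-X²)) = c L(p) and B kills even polynomials. The rest
is algebra based on L(p²) > 0 and L(X p²) > 0 for p ≠ 0.

For m even, the form B(fg) splits into an even block c L(pq) and an odd block -c L(X pq), both
definite. So there is one orthogonal polynomial in each degree: φ_n(-X²) in even degree, and X times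
the Christoffel kernel polynomial of φ_n, φ_{n+1} at -X² in odd degree, up to sign. For m odd, B
pairs even polynomials with odd ones. The pairing is perfect below degree 2n, which again gives
φ_n(-X²), but a polynomial orthogonal at level 2n + 1 is forced to be even and cannot have odd
degree. -/

/-! ### The power series of the Bessel function -/

/-- The coefficients of the entire function `besselEntire ν`. -/
noncomputable def besselCoeff (ν : ℝ) (k : ℕ) : ℝ :=
  (-1) ^ k / ((k.factorial : ℝ) * Real.Gamma (ν + k + 1))

/-- The entire function `h_ν` with `J_ν(x) = (x / 2) ^ ν h_ν((x / 2) ^ 2)`. -/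
noncomputable def besselEntire (ν z : ℝ) : ℝ := ∑' k : ℕ, besselCoeff ν k * z ^ k

/-- With the convention 1/Γ = 0 at the poles the functional equation needs no exception, which is
what lets ν be a negative integer. -/
theorem inv_Gamma_eq_self_mul_inv_Gamma_add_one (s : ℝ) :
    (Real.Gamma s)⁻¹ = s * (Real.Gamma (s + 1))⁻¹ := by
  rcases eq_or_ne s 0 with rfl | hs
  · simp
  · rw [Real.Gamma_add_one hs, mul_inv, mul_inv_cancel_left₀ hs]

/-- Once k ≥ -ν the factor ν + k + 1 is at least 1, so the sequence decreases from there on; the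
finitely many earlier terms are absorbed by a sum. -/
theorem exists_abs_inv_Gamma_le (ν : ℝ) :
    ∃ C, ∀ k : ℕ, |(Real.Gamma (ν + k + 1))⁻¹| ≤ C := by
  obtain ⟨K, hK⟩ := exists_nat_ge (-ν)
  set u : ℕ → ℝ := fun k => |(Real.Gamma (ν + k + 1))⁻¹| with hu
  have hstep : ∀ k, K ≤ k → u (k + 1) ≤ u k := by
    intro k hk
    have hk' : (K : ℝ) ≤ k := by exact_mod_cast hk
    have h := inv_Gamma_eq_self_mul_inv_Gamma_add_one (ν + k + 1)
    simp only [hu]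
    rw [h, abs_mul, abs_of_nonneg (by linarith : 0 ≤ ν + k + 1)]
    push_cast
    rw [← add_assoc]
    exact le_mul_of_one_le_left (abs_nonneg _) (by linarith)
  refine ⟨∑ i ∈ Finset.range (K + 1), u i, fun k => ?_⟩
  have hle : ∀ i ∈ Finset.range (K + 1), u i ≤ ∑ i ∈ Finset.range (K + 1), u i := fun i hi =>
    Finset.single_le_sum (f := u) (fun j _ => abs_nonneg _) hi
  rcases le_total k K with h | h
  · exact hle k (Finset.mem_range.2 (by omega))
  · refine le_trans ?_ (hle K (Finset.mem_range.2 (by omega)))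
    induction k, h using Nat.le_induction with
    | base => exact le_rfl
    | succ k hk ih => exact (hstep k hk).trans ih

theorem exists_abs_besselCoeff_le (ν : ℝ) :
    ∃ C, 0 ≤ C ∧ ∀ k, |besselCoeff ν k| ≤ C * (k.factorial : ℝ)⁻¹ := by
  obtain ⟨C, hC⟩ := exists_abs_inv_Gamma_le ν
  refine ⟨C, (abs_nonneg _).trans (hC 0), fun k => ?_⟩
  have h := hC k
  rw [besselCoeff, abs_div, abs_mul, abs_pow, abs_neg, abs_one, one_pow, one_div, mul_inv,
    Nat.abs_cast, mul_comm, ← abs_inv]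
  gcongr

theorem succ_mul_besselCoeff_succ (ν : ℝ) (k : ℕ) :
    (k + 1) * besselCoeff ν (k + 1) = -besselCoeff (ν + 1) k := by
  have h : ((k : ℝ) + 1) ≠ 0 := by positivity
  have h2 : (k.factorial : ℝ) ≠ 0 := by positivity
  rw [besselCoeff, besselCoeff, show ν + ((k + 1 : ℕ) : ℝ) + 1 = ν + 1 + k + 1 by push_cast; ring,
    Nat.factorial_succ, div_eq_mul_inv, div_eq_mul_inv, mul_inv, mul_inv]
  push_cast
  field_simp
  ring

theorem besselCoeff_eq_mul_besselCoeff_add_one (ν : ℝ) (k : ℕ) :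
    besselCoeff ν k = (ν + 1 + k) * besselCoeff (ν + 1) k := by
  rw [besselCoeff, besselCoeff, div_eq_mul_inv, div_eq_mul_inv, mul_inv, mul_inv,
    inv_Gamma_eq_self_mul_inv_Gamma_add_one (ν + k + 1),
    show ν + (k : ℝ) + 1 + 1 = ν + 1 + k + 1 by ring]
  ring

theorem summable_besselCoeff_mul_pow (ν z : ℝ) : Summable fun k => besselCoeff ν k * z ^ k := by
  obtain ⟨C, hC0, hC⟩ := exists_abs_besselCoeff_le ν
  refine Summable.of_norm_bounded ((Real.summable_pow_div_factorial |z|).mul_left C) fun k => ?_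
  rw [Real.norm_eq_abs, abs_mul, abs_pow, div_eq_inv_mul, ← mul_assoc]
  gcongr
  exact hC k

theorem hasDerivAt_besselEntire (ν z : ℝ) :
    HasDerivAt (besselEntire ν) (-besselEntire (ν + 1) z) z := by
  obtain ⟨C, hC0, hC⟩ := exists_abs_besselCoeff_le ν
  set R := |z| + 1
  have hR : 0 ≤ R := by positivity
  have key : HasDerivAt (besselEntire ν)
      (∑' k : ℕ, besselCoeff ν k * (k * z ^ (k - 1))) z := by
    refine hasDerivAt_tsum_of_isPreconnected (𝕜 := ℝ) (F := ℝ)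
      (g := fun k y => besselCoeff ν k * y ^ k)
      (g' := fun k y => besselCoeff ν k * (k * y ^ (k - 1)))
      (u := fun k : ℕ => C * ((k.factorial : ℝ)⁻¹ * (k * R ^ (k - 1))))
      (t := Metric.ball 0 R) (y₀ := 0) ?_ Metric.isOpen_ball
      (convex_ball (0 : ℝ) R).isPreconnected ?_ ?_ ?_ ?_ ?_
    · refine Summable.mul_left _ ((summable_nat_add_iff 1).1 ?_)
      refine (Real.summable_pow_div_factorial R).congr fun k => ?_
      rw [Nat.factorial_succ, Nat.add_sub_cancel]
      push_cast
      have h : ((k : ℝ) + 1) ≠ 0 := by positivity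
      field_simp
    · intro k y _
      exact (hasDerivAt_pow k y).const_mul _
    · intro k y hy
      rw [mem_ball_zero_iff, Real.norm_eq_abs] at hy
      rw [Real.norm_eq_abs, abs_mul, abs_mul, abs_pow, Nat.abs_cast, ← mul_assoc C]
      gcongr
      exact hC k
    · simp only [Metric.mem_ball, dist_self]; positivity
    · exact summable_besselCoeff_mul_pow ν 0
    · rw [mem_ball_zero_iff, Real.norm_eq_abs]; simp [R]
  convert key using 1
  have hs : Summable fun k : ℕ => besselCoeff ν k * (k * z ^ (k - 1)) := by
    refine (summable_nat_add_iff 1).1 ((summable_besselCoeff_mul_pow (ν + 1) z).neg.congr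
      fun k => ?_)
    rw [Nat.add_sub_cancel, ← neg_mul, ← succ_mul_besselCoeff_succ]
    push_cast
    ring
  rw [hs.tsum_eq_zero_add, besselEntire, ← tsum_neg]
  simp only [CharP.cast_eq_zero, zero_mul, mul_zero, zero_add]
  refine tsum_congr fun k => ?_
  rw [Nat.add_sub_cancel, ← neg_mul, ← succ_mul_besselCoeff_succ]
  push_cast
  ring

/-- This contiguous relation is the three-term recurrence of the Bessel functions. It supplies the
second derivative formula, `hasDerivAt_besselJ_add_one`. -/
theorem besselEntire_eq (ν z : ℝ) :
    besselEntire ν z = (ν + 1) * besselEntire (ν + 1) z - z * besselEntire (ν + 2) z := by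
  have h1 := summable_besselCoeff_mul_pow (ν + 1) z
  have h2 := summable_besselCoeff_mul_pow (ν + 2) z
  have h3 : Summable fun k : ℕ => k * (besselCoeff (ν + 1) k * z ^ k) := by
    refine (summable_nat_add_iff 1).1 ((h2.mul_left (-z)).congr fun k => ?_)
    have := succ_mul_besselCoeff_succ (ν + 1) k
    rw [show ν + 1 + 1 = ν + 2 by ring] at this
    push_cast
    rw [← mul_assoc ((k : ℝ) + 1), this, pow_succ]
    ring
  have h4 : -(z * besselEntire (ν + 2) z) = ∑' k : ℕ, k * (besselCoeff (ν + 1) k * z ^ k) := by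
    rw [h3.tsum_eq_zero_add, besselEntire, ← tsum_mul_left, ← tsum_neg]
    simp only [CharP.cast_eq_zero, zero_mul, zero_add]
    refine tsum_congr fun k => ?_
    have := succ_mul_besselCoeff_succ (ν + 1) k
    rw [show ν + 1 + 1 = ν + 2 by ring] at this
    push_cast
    rw [← mul_assoc ((k : ℝ) + 1), this, pow_succ]
    ring
  rw [sub_eq_add_neg, h4, besselEntire, besselEntire, ← tsum_mul_left,
    ← (h1.mul_left _).tsum_add h3]
  refine tsum_congr fun k => ?_
  rw [besselCoeff_eq_mul_besselCoeff_add_one]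
  ring

theorem besselEntire_zero (ν : ℝ) : besselEntire ν 0 = (Real.Gamma (ν + 1))⁻¹ := by
  rw [besselEntire, tsum_eq_single 0 fun k hk => by simp [hk]]
  simp [besselCoeff]

theorem continuous_besselEntire (ν : ℝ) : Continuous (besselEntire ν) :=
  continuous_iff_continuousAt.2 fun z => (hasDerivAt_besselEntire ν z).continuousAt

theorem besselJ_eq (ν : ℝ) {x : ℝ} (hx : 0 < x) :
    besselJ ν x = (x / 2) ^ ν * besselEntire ν ((x / 2) ^ 2) := by
  rw [besselJ, besselEntire, ← tsum_mul_left]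
  refine tsum_congr fun k => ?_
  rw [Real.rpow_add (by positivity), besselCoeff, ← pow_mul]
  rw [show 2 * (k : ℝ) = ((2 * k : ℕ) : ℝ) by push_cast; ring, Real.rpow_natCast]
  ring

/-! ### Derivatives and growth of the Bessel function -/

theorem hasDerivAt_besselJ (ν : ℝ) {x : ℝ} (hx : 0 < x) :
    HasDerivAt (besselJ ν) (ν / x * besselJ ν x - besselJ (ν + 1) x) x := by
  have h2 : HasDerivAt (fun y : ℝ => y / 2) (1 / 2) x := (hasDerivAt_id x).div_const 2
  have h := (h2.rpow_const (p := ν) (Or.inl (by positivity))).mul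
    ((hasDerivAt_besselEntire ν ((x / 2) ^ 2)).comp x (h2.pow 2))
  refine (h.congr_of_eventuallyEq ?_).congr_deriv ?_
  · filter_upwards [lt_mem_nhds hx] with y hy
    exact besselJ_eq ν hy
  · rw [besselJ_eq _ hx, besselJ_eq _ hx, Real.rpow_sub_one (by positivity),
      Real.rpow_add_one (by positivity)]
    simp only [Function.comp, Nat.cast_ofNat, Pi.pow_apply]
    field_simp
    ring

theorem hasDerivAt_besselJ_add_one (ν : ℝ) {x : ℝ} (hx : 0 < x) :
    HasDerivAt (besselJ (ν + 1)) (besselJ ν x - (ν + 1) / x * besselJ (ν + 1) x) x := by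
  refine (hasDerivAt_besselJ (ν + 1) hx).congr_deriv ?_
  rw [show ν + 1 + 1 = ν + 2 by ring, besselJ_eq _ hx, besselJ_eq _ hx, besselJ_eq _ hx,
    besselEntire_eq ν, show ν + 2 = ν + 1 + 1 by ring,
    Real.rpow_add_one (by positivity) (ν + 1), Real.rpow_add_one (by positivity) ν]
  field_simp
  ring

theorem continuousOn_besselJ (ν : ℝ) : ContinuousOn (besselJ ν) (Set.Ioi 0) := fun _ hx =>
  (hasDerivAt_besselJ ν hx).continuousAt.continuousWithinAt

/-- In the derivative of J_ν² + J_{ν+1}² the cross terms cancel, and the damping x^(-2a) with a =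
|ν| + 1 makes what remains nonpositive. The crude polynomial bound suffices against e^(-sx). -/
theorem exists_abs_besselJ_le_of_one_le (ν : ℝ) :
    ∃ C, 0 ≤ C ∧ ∀ x, 1 ≤ x → |besselJ ν x| ≤ C * x ^ (|ν| + 1) := by
  set a := |ν| + 1 with ha
  set G : ℝ → ℝ := fun x => (besselJ ν x ^ 2 + besselJ (ν + 1) x ^ 2) * x ^ (-(2 * a)) with hG
  have hd : ∀ x, 0 < x → HasDerivAt G
      ((2 * besselJ ν x * (ν / x * besselJ ν x - besselJ (ν + 1) x) + 2 * besselJ (ν + 1) x *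
        (besselJ ν x - (ν + 1) / x * besselJ (ν + 1) x)) * x ^ (-(2 * a)) +
        (besselJ ν x ^ 2 + besselJ (ν + 1) x ^ 2) * (-(2 * a) * x ^ (-(2 * a) - 1))) x := by
    intro x hx
    refine ((((hasDerivAt_besselJ ν hx).pow 2).add
      ((hasDerivAt_besselJ_add_one ν hx).pow 2)).mul
      (Real.hasDerivAt_rpow_const (p := -(2 * a)) (Or.inl hx.ne'))).congr_deriv ?_
    simp
  have hanti : AntitoneOn G (Set.Ici 1) := by
    refine antitoneOn_of_deriv_nonpos (convex_Ici 1)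
      (fun x hx => (hd x (zero_lt_one.trans_le hx)).continuousAt.continuousWithinAt)
      (fun x hx => ?_) fun x hx => ?_
    · rw [interior_Ici, Set.mem_Ioi] at hx
      exact (hd x (zero_lt_one.trans hx)).differentiableAt.differentiableWithinAt
    · rw [interior_Ici, Set.mem_Ioi] at hx
      have hx0 := zero_lt_one.trans hx
      rw [(hd x hx0).deriv, Real.rpow_sub_one hx0.ne']
      have e : (2 * besselJ ν x * (ν / x * besselJ ν x - besselJ (ν + 1) x) +
          2 * besselJ (ν + 1) x *
          (besselJ ν x - (ν + 1) / x * besselJ (ν + 1) x)) * x ^ (-(2 * a)) +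
          (besselJ ν x ^ 2 + besselJ (ν + 1) x ^ 2) * (-(2 * a) * (x ^ (-(2 * a)) / x)) =
          -(2 * (x ^ (-(2 * a)) / x) * ((a - ν) * besselJ ν x ^ 2 +
            (a + ν + 1) * besselJ (ν + 1) x ^ 2)) := by
        field_simp
        ring
      rw [e, neg_nonpos]
      have h1 : 0 ≤ a - ν := by have := le_abs_self ν; linarith
      have h2 : 0 ≤ a + ν + 1 := by have := neg_abs_le ν; linarith
      positivity
  refine ⟨√(G 1), Real.sqrt_nonneg _, fun x hx => ?_⟩
  have hx0 := zero_lt_one.trans_le hx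
  have h := hanti Set.self_mem_Ici hx hx
  have hxa : 0 < x ^ a := by positivity
  have e : x ^ (-(2 * a)) = (x ^ a * x ^ a)⁻¹ := by
    rw [Real.rpow_neg hx0.le, two_mul, Real.rpow_add hx0]
  rw [hG] at h
  simp only [e] at h
  rw [← div_eq_mul_inv, div_le_iff₀ (by positivity)] at h
  refine abs_le_of_sq_le_sq ?_ (by positivity)
  rw [mul_pow, Real.sq_sqrt (by simp only [hG]; positivity)]
  simp only [hG]
  nlinarith [sq_nonneg (besselJ (ν + 1) x)]

theorem exists_abs_besselJ_le (ν : ℝ) :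
    ∃ C, 0 ≤ C ∧ ∀ x, 0 < x → |besselJ ν x| ≤ C * (x ^ ν + x ^ (|ν| + 1)) := by
  obtain ⟨C, hC0, hC⟩ := exists_abs_besselJ_le_of_one_le ν
  obtain ⟨D, hD⟩ := (isCompact_Icc (a := (0 : ℝ)) (b := 1)).exists_bound_of_continuousOn
    (continuous_besselEntire ν).continuousOn
  have hD0 : 0 ≤ D := (norm_nonneg _).trans (hD 0 (by simp))
  have h2 : 0 ≤ ((1 : ℝ) / 2) ^ ν := by positivity
  refine ⟨C + (1 / 2) ^ ν * D, by positivity, fun x hx => ?_⟩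
  have hx1 : 0 < x ^ ν := by positivity
  have hx2 : 0 < x ^ (|ν| + 1) := by positivity
  rcases le_total 1 x with h | h
  · have := hC x h
    have := mul_nonneg hC0 hx1.le
    have := mul_nonneg (mul_nonneg h2 hD0) (add_nonneg hx1.le hx2.le)
    nlinarith
  · rw [besselJ_eq ν hx, abs_mul, abs_of_nonneg (by positivity), div_eq_mul_one_div,
      Real.mul_rpow hx.le (by norm_num)]
    have h3 := hD ((x * (1 / 2)) ^ 2) ⟨by positivity, by nlinarith⟩
    rw [Real.norm_eq_abs] at h3
    have h4 := mul_le_mul_of_nonneg_left h3 (mul_nonneg hx1.le h2)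
    have := mul_nonneg hC0 (add_nonneg hx1.le hx2.le)
    have := mul_nonneg (mul_nonneg h2 hD0) hx2.le
    nlinarith

/-! ### Laplace transforms of the Bessel function -/

/-- The Laplace transform of `x ^ b J_ν(x)`. -/
noncomputable def besselLaplace (ν b s : ℝ) : ℝ :=
  ∫ x in Set.Ioi (0 : ℝ), x ^ b * besselJ ν x * Real.exp (-s * x)

theorem integrableOn_rpow_mul_exp_neg_mul {b s : ℝ} (hb : -1 < b) (hs : 0 < s) :
    IntegrableOn (fun x : ℝ => x ^ b * Real.exp (-s * x)) (Set.Ioi 0) := by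
  simpa using integrableOn_rpow_mul_exp_neg_mul_rpow hb zero_lt_one hs

/-- Only a one-sided limit at a is assumed, since real powers and `besselJ` take conventional values
at 0; f is redefined at a to be continuous there. -/
theorem integral_Ioi_of_hasDerivAt_of_tendsto_nhdsGT {f f' : ℝ → ℝ} {a l m : ℝ}
    (hl : Tendsto f (𝓝[>] a) (𝓝 l)) (hderiv : ∀ x ∈ Set.Ioi a, HasDerivAt f (f' x) x)
    (hint : IntegrableOn f' (Set.Ioi a)) (hm : Tendsto f atTop (𝓝 m)) :
    ∫ x in Set.Ioi a, f' x = m - l := by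
  have h := integral_Ioi_of_hasDerivAt_of_tendsto (f := Function.update f a l) (f' := f') (m := m)
    (a := a) ?_ ?_ hint ?_
  · simpa using h
  · rw [continuousWithinAt_update_same]
    simpa using hl
  · intro x hx
    refine (hderiv x hx).congr_of_eventuallyEq ?_
    filter_upwards [lt_mem_nhds (Set.mem_Ioi.1 hx)] with y hy
    exact Function.update_of_ne hy.ne' _ _
  · refine hm.congr' ?_
    filter_upwards [eventually_gt_atTop a] with y hy
    exact (Function.update_of_ne hy.ne' _ _).symm

theorem continuousOn_besselLaplace_integrand (ν b s : ℝ) :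
    ContinuousOn (fun x => x ^ b * besselJ ν x * Real.exp (-s * x)) (Set.Ioi 0) := by
  refine ((continuousOn_id.rpow_const fun x hx => Or.inl (ne_of_gt hx)).mul
    (continuousOn_besselJ ν)).mul (Continuous.continuousOn (by fun_prop))

theorem abs_besselLaplace_integrand_le {ν C : ℝ}
    (hC : ∀ x, 0 < x → |besselJ ν x| ≤ C * (x ^ ν + x ^ (|ν| + 1))) (b s : ℝ) {x : ℝ}
    (hx : 0 < x) : |x ^ b * besselJ ν x * Real.exp (-s * x)| ≤
      C * (x ^ (b + ν) * Real.exp (-s * x) + x ^ (b + (|ν| + 1)) * Real.exp (-s * x)) := by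
  rw [abs_mul, abs_mul, Real.abs_exp, abs_of_pos (Real.rpow_pos_of_pos hx b), Real.rpow_add hx,
    Real.rpow_add hx]
  calc _ ≤ x ^ b * (C * (x ^ ν + x ^ (|ν| + 1))) * Real.exp (-s * x) := by
        gcongr
        exact hC x hx
    _ = _ := by ring

theorem integrableOn_besselLaplace {ν b s : ℝ} (hb : -1 < b + ν) (hs : 0 < s) :
    IntegrableOn (fun x => x ^ b * besselJ ν x * Real.exp (-s * x)) (Set.Ioi 0) := by
  obtain ⟨C, hC0, hC⟩ := exists_abs_besselJ_le ν
  have hb' : -1 < b + (|ν| + 1) := by have := le_abs_self ν; linarith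
  refine Integrable.mono' (((integrableOn_rpow_mul_exp_neg_mul hb hs).add
    (integrableOn_rpow_mul_exp_neg_mul hb' hs)).const_mul C)
    ((continuousOn_besselLaplace_integrand ν b s).aestronglyMeasurable measurableSet_Ioi) ?_
  filter_upwards [ae_restrict_mem measurableSet_Ioi] with x hx
  exact abs_besselLaplace_integrand_le hC b s hx

theorem tendsto_besselLaplace_integrand_zero {ν b : ℝ} (s : ℝ) (hb : 0 < b + ν) :
    Tendsto (fun x => x ^ b * besselJ ν x * Real.exp (-s * x)) (𝓝[>] 0) (𝓝 0) := by
  obtain ⟨C, hC0, hC⟩ := exists_abs_besselJ_le ν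
  have hb' : 0 < b + (|ν| + 1) := by have := le_abs_self ν; linarith
  have hlim : Tendsto (fun x : ℝ => C * (x ^ (b + ν) * Real.exp (-s * x) +
      x ^ (b + (|ν| + 1)) * Real.exp (-s * x))) (𝓝[>] 0) (𝓝 0) := by
    have hc : Continuous fun x : ℝ => C * (x ^ (b + ν) * Real.exp (-s * x) +
        x ^ (b + (|ν| + 1)) * Real.exp (-s * x)) :=
      continuous_const.mul (((Real.continuous_rpow_const hb.le).mul (by fun_prop)).add
        ((Real.continuous_rpow_const hb'.le).mul (by fun_prop)))
    have := (hc.tendsto 0).mono_left (nhdsWithin_le_nhds (s := Set.Ioi 0))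
    simpa [Real.zero_rpow hb.ne', Real.zero_rpow hb'.ne'] using this
  refine squeeze_zero_norm' ?_ hlim
  filter_upwards [self_mem_nhdsWithin] with x hx
  exact abs_besselLaplace_integrand_le hC b s hx

/-- The derivative of x^b J_ν(x) e^(-sx) integrates to 0. The parameters α, κ, lam cover both
derivative formulas, the one raising and the one lowering the order. -/
theorem besselLaplace_integral_deriv {ν b s α β κ lam : ℝ} (hb : 0 < b + ν) (hs : 0 < s)
    (hκ : -1 < b + κ)
    (hJ : ∀ x, 0 < x → HasDerivAt (besselJ ν) (α / x * besselJ ν x + lam * besselJ κ x) x)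
    (hβ : β = b + α) :
    β * besselLaplace ν (b - 1) s - s * besselLaplace ν b s + lam * besselLaplace κ b s = 0 := by
  have i1 : IntegrableOn (fun x => x ^ (b - 1) * besselJ ν x * Real.exp (-s * x)) (Set.Ioi 0) :=
    integrableOn_besselLaplace (by linarith) hs
  have i2 : IntegrableOn (fun x => x ^ b * besselJ ν x * Real.exp (-s * x)) (Set.Ioi 0) :=
    integrableOn_besselLaplace (by linarith) hs
  have i3 : IntegrableOn (fun x => x ^ b * besselJ κ x * Real.exp (-s * x)) (Set.Ioi 0) :=
    integrableOn_besselLaplace hκ hs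
  have i : IntegrableOn (fun x => β * (x ^ (b - 1) * besselJ ν x * Real.exp (-s * x)) -
      s * (x ^ b * besselJ ν x * Real.exp (-s * x)) +
      lam * (x ^ b * besselJ κ x * Real.exp (-s * x))) (Set.Ioi 0) :=
    ((i1.const_mul β).sub (i2.const_mul s)).add (i3.const_mul lam)
  have hd : ∀ x ∈ Set.Ioi (0 : ℝ), HasDerivAt (fun x => x ^ b * besselJ ν x * Real.exp (-s * x))
      (β * (x ^ (b - 1) * besselJ ν x * Real.exp (-s * x)) -
      s * (x ^ b * besselJ ν x * Real.exp (-s * x)) +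
      lam * (x ^ b * besselJ κ x * Real.exp (-s * x))) x := by
    intro x hx
    have hx : 0 < x := hx
    refine (((Real.hasDerivAt_rpow_const (p := b) (Or.inl hx.ne')).mul (hJ x hx)).mul
      ((hasDerivAt_id x).const_mul (-s)).exp).congr_deriv ?_
    rw [Real.rpow_sub_one hx.ne', hβ]
    simp only [Pi.mul_apply, id]
    field_simp
    ring
  have h := integral_Ioi_of_hasDerivAt_of_tendsto_nhdsGT
    (tendsto_besselLaplace_integrand_zero s hb) hd i
    (tendsto_zero_of_hasDerivAt_of_integrableOn_Ioi hd i i2)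
  have i12 : IntegrableOn (fun x => β * (x ^ (b - 1) * besselJ ν x * Real.exp (-s * x)) -
      s * (x ^ b * besselJ ν x * Real.exp (-s * x))) (Set.Ioi 0) :=
    (i1.const_mul β).sub (i2.const_mul s)
  rw [integral_add i12 (i3.const_mul lam),
    integral_sub (i1.const_mul β) (i2.const_mul s), integral_const_mul, integral_const_mul,
    integral_const_mul, sub_zero] at h
  exact h

theorem besselLaplace_add_one_left {ν b s : ℝ} (hb : 0 < b + ν) (hs : 0 < s) :
    besselLaplace (ν + 1) b s =
      (b + ν) * besselLaplace ν (b - 1) s - s * besselLaplace ν b s := by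
  have h := besselLaplace_integral_deriv (α := ν) (κ := ν + 1) (lam := -1) hb hs (by linarith)
    (fun x hx => by simpa [sub_eq_add_neg] using hasDerivAt_besselJ ν hx) rfl
  linarith

theorem besselLaplace_eq {ν b s : ℝ} (hb : -1 < b + ν) (hs : 0 < s) :
    besselLaplace ν b s =
      s * besselLaplace (ν + 1) b s - (b - ν - 1) * besselLaplace (ν + 1) (b - 1) s := by
  have h := besselLaplace_integral_deriv (ν := ν + 1) (b := b) (α := -(ν + 1)) (κ := ν) (lam := 1)
    (by linarith) hs hb
    (fun x hx => (hasDerivAt_besselJ_add_one ν hx).congr_deriv (by ring)) rfl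
  linarith

theorem hasDerivAt_besselLaplace {ν b s : ℝ} (hb : -1 < b + ν) (hs : 0 < s) :
    HasDerivAt (besselLaplace ν b) (-besselLaplace ν (b + 1) s) s := by
  have i := integrableOn_besselLaplace (b := b + 1) (by linarith) (half_pos hs) (ν := ν)
  have h := hasDerivAt_integral_of_dominated_loc_of_deriv_le
    (μ := volume.restrict (Set.Ioi (0 : ℝ)))
    (F := fun s x => x ^ b * besselJ ν x * Real.exp (-s * x))
    (F' := fun s x => -(x ^ (b + 1) * besselJ ν x * Real.exp (-s * x)))
    (bound := fun x => ‖x ^ (b + 1) * besselJ ν x * Real.exp (-(s / 2) * x)‖)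
    (Ioi_mem_nhds (half_lt_self hs))
    (Eventually.of_forall fun t =>
      (continuousOn_besselLaplace_integrand ν b t).aestronglyMeasurable measurableSet_Ioi)
    (integrableOn_besselLaplace hb hs)
    ((continuousOn_besselLaplace_integrand ν (b + 1) s).aestronglyMeasurable
      measurableSet_Ioi).neg ?_ i.norm ?_
  · have h2 := h.2
    rw [integral_neg] at h2
    exact h2
  · filter_upwards [ae_restrict_mem measurableSet_Ioi] with x hx t ht
    have hx : 0 < x := hx
    have ht : s / 2 < t := ht
    rw [norm_neg, norm_mul, norm_mul _ (Real.exp _), Real.norm_eq_abs (Real.exp _),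
      Real.norm_eq_abs (Real.exp _), Real.abs_exp, Real.abs_exp]
    gcongr
  · filter_upwards [ae_restrict_mem measurableSet_Ioi] with x hx t ht
    have hx : 0 < x := hx
    refine (((hasDerivAt_id t).neg.mul_const x).exp.const_mul
      (x ^ b * besselJ ν x)).congr_deriv ?_
    rw [Real.rpow_add_one hx.ne']
    simp only [id, Pi.neg_apply]
    ring

/-- At b = ν + 1 the two recurrences close up into the differential equation (1 + s²) F' = -(2ν + 1)
s F for F = `besselLaplace ν ν`. -/
theorem exists_besselLaplace_self_eq {ν : ℝ} (hν : -1 < 2 * ν) :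
    ∃ c, ∀ s, 0 < s → besselLaplace ν ν s * (1 + s ^ 2) ^ (ν + 1 / 2) = c := by
  obtain ⟨κ, hκ⟩ : ∃ κ, κ = ν + 1 / 2 := ⟨_, rfl⟩
  rw [← hκ]
  have hd : ∀ s, 0 < s → HasDerivAt
      (fun s => besselLaplace ν ν s * (1 + s ^ 2) ^ κ) 0 s := by
    intro s hs
    have hs2 : 0 < 1 + s ^ 2 := by positivity
    have h1 := besselLaplace_eq (ν := ν) (b := ν + 1) (by linarith) hs
    have h2 := besselLaplace_add_one_left (ν := ν) (b := ν + 1) (by linarith) hs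
    rw [show ν + 1 - ν - 1 = 0 by ring, zero_mul, sub_zero] at h1
    rw [add_sub_cancel_right] at h2
    refine ((hasDerivAt_besselLaplace (by linarith) hs).mul
      (((hasDerivAt_pow 2 s).const_add 1).rpow_const (p := κ)
        (Or.inl hs2.ne'))).congr_deriv ?_
    rw [Real.rpow_sub_one hs2.ne']
    field_simp
    push_cast
    have h3 : (1 + s ^ 2) * besselLaplace ν (ν + 1) s = s * (2 * κ) * besselLaplace ν ν s := by
      rw [h2] at h1
      rw [hκ]
      linear_combination h1
    linear_combination -(1 + s ^ 2) ^ κ * h3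
  exact ⟨_, fun s hs => IsOpen.is_const_of_deriv_eq_zero isOpen_Ioi isPreconnected_Ioi
    (fun s hs => (hd s hs).differentiableAt.differentiableWithinAt)
    (fun s hs => (hd s hs).deriv) hs (Set.mem_Ioi.2 zero_lt_one)⟩

/-- As s → ∞ only the leading behaviour of J_ν at 0 matters: after rescaling, the transform tends to
a nonzero multiple of Γ(2ν + 1) / Γ(ν + 1). -/
theorem exists_besselLaplace_self_ne_zero {ν : ℝ} (hν : -1 < 2 * ν) :
    ∃ s, 0 < s ∧ besselLaplace ν ν s ≠ 0 := by
  by_contra! h0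
  obtain ⟨C, hC0, hC⟩ := exists_abs_besselJ_le ν
  set a := |ν| + 1 - ν with ha
  have ha0 : 0 ≤ a := by have := le_abs_self ν; linarith
  have hH : ∀ x, 0 < x → |besselEntire ν ((x / 2) ^ 2)| ≤ C * 2 ^ ν * (1 + x ^ a) := by
    intro x hx
    have h := hC x hx
    have hx' : 0 < x ^ ν := by positivity
    have h2 : (0 : ℝ) < 2 ^ ν := by positivity
    rw [besselJ_eq ν hx, abs_mul, abs_of_nonneg (by positivity), Real.div_rpow hx.le zero_le_two,
      show |ν| + 1 = ν + a by rw [ha]; ring, Real.rpow_add hx, div_mul_eq_mul_div,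
      div_le_iff₀ h2] at h
    refine le_of_mul_le_mul_left (h.trans (le_of_eq ?_)) hx'
    ring
  -- Substitute x = r u with r = 1 / (n + 1) in the transform at s = n + 1 and drop the nonzero
  -- power of r.
  have hzero : ∀ n : ℕ, ∫ u in Set.Ioi (0 : ℝ),
      u ^ (2 * ν) * besselEntire ν (((n + 1 : ℝ)⁻¹ * u / 2) ^ 2) * Real.exp (-1 * u) = 0 := by
    intro n
    set r : ℝ := (n + 1 : ℝ)⁻¹ with hr
    have hr0 : 0 < r := by positivity
    have h := integral_comp_mul_left_Ioi
      (fun x => x ^ ν * besselJ ν x * Real.exp (-r⁻¹ * x)) 0 hr0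
    have h1 := h0 r⁻¹ (by positivity)
    rw [besselLaplace] at h1
    rw [mul_zero, h1, smul_zero] at h
    have h2 : ∫ u in Set.Ioi (0 : ℝ), (r ^ (2 * ν) * 2 ^ (-ν)) *
        (u ^ (2 * ν) * besselEntire ν ((r * u / 2) ^ 2) * Real.exp (-1 * u)) = 0 := by
      refine Eq.trans (setIntegral_congr_fun measurableSet_Ioi fun u hu => ?_) h
      have hu : 0 < u := hu
      rw [besselJ_eq ν (by positivity), show -r⁻¹ * (r * u) = -1 * u by field_simp,
        Real.div_rpow (by positivity) zero_le_two, Real.mul_rpow hr0.le hu.le, two_mul,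
        Real.rpow_add hr0, Real.rpow_add hu, Real.rpow_neg zero_le_two]
      ring
    rw [integral_const_mul] at h2
    have h3 : r ^ (2 * ν) * 2 ^ (-ν) ≠ 0 := by positivity
    exact (mul_eq_zero.1 h2).resolve_left h3
  have hlim := tendsto_integral_of_dominated_convergence (μ := volume.restrict (Set.Ioi (0 : ℝ)))
    (F := fun (n : ℕ) u => u ^ (2 * ν) * besselEntire ν (((n + 1 : ℝ)⁻¹ * u / 2) ^ 2) *
      Real.exp (-1 * u))
    (f := fun u => u ^ (2 * ν) * besselEntire ν 0 * Real.exp (-1 * u))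
    (fun u => C * 2 ^ ν * (u ^ (2 * ν) * Real.exp (-1 * u) +
      u ^ (2 * ν + a) * Real.exp (-1 * u))) ?_ ?_ ?_ ?_
  · simp only [hzero] at hlim
    have h1 := tendsto_nhds_unique hlim tendsto_const_nhds
    have h2 : ∫ u in Set.Ioi (0 : ℝ), u ^ (2 * ν) * besselEntire ν 0 * Real.exp (-1 * u) =
        besselEntire ν 0 * Real.Gamma (2 * ν + 1) := by
      rw [Real.Gamma_eq_integral (by linarith), ← integral_const_mul]
      refine setIntegral_congr_fun measurableSet_Ioi fun u hu => ?_
      rw [add_sub_cancel_right, neg_one_mul]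
      ring
    have h3 : 0 < Real.Gamma (2 * ν + 1) := Real.Gamma_pos_of_pos (by linarith)
    have h4 : 0 < Real.Gamma (ν + 1) := Real.Gamma_pos_of_pos (by linarith)
    rw [h2, besselEntire_zero] at h1
    exact (by positivity : (Real.Gamma (ν + 1))⁻¹ * Real.Gamma (2 * ν + 1) ≠ 0) h1
  · intro n
    refine ContinuousOn.aestronglyMeasurable ?_ measurableSet_Ioi
    refine ((continuousOn_id.rpow_const fun x hx => Or.inl (ne_of_gt hx)).mul
      ((continuous_besselEntire ν).comp (by fun_prop)).continuousOn).mul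
      (Continuous.continuousOn (by fun_prop))
  · exact ((integrableOn_rpow_mul_exp_neg_mul hν one_pos).add
      (integrableOn_rpow_mul_exp_neg_mul (by linarith) one_pos)).const_mul _
  · intro n
    filter_upwards [ae_restrict_mem measurableSet_Ioi] with u hu
    have hu : 0 < u := hu
    have hr1 : (n + 1 : ℝ)⁻¹ ≤ 1 := inv_le_one_of_one_le₀ (by linarith [n.cast_nonneg (α := ℝ)])
    have hr0 : 0 < (n + 1 : ℝ)⁻¹ := by positivity
    rw [norm_mul, norm_mul, Real.norm_eq_abs, Real.norm_eq_abs, Real.norm_eq_abs, Real.abs_exp,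
      abs_of_nonneg (by positivity), Real.rpow_add hu]
    have h1 : |besselEntire ν (((n + 1 : ℝ)⁻¹ * u / 2) ^ 2)| ≤ C * 2 ^ ν * (1 + u ^ a) := by
      refine (hH _ (by positivity)).trans ?_
      gcongr
      exact mul_le_of_le_one_left hu.le hr1
    calc _ ≤ u ^ (2 * ν) * (C * 2 ^ ν * (1 + u ^ a)) * Real.exp (-1 * u) := by gcongr
      _ = _ := by ring
  · filter_upwards with u
    have hr : Tendsto (fun n : ℕ => (n + 1 : ℝ)⁻¹) atTop (𝓝 0) := by
      simpa using tendsto_one_div_add_atTop_nhds_zero_nat (𝕜 := ℝ)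
    have h1 : Tendsto (fun n : ℕ => ((n + 1 : ℝ)⁻¹ * u / 2) ^ 2) atTop (𝓝 0) := by
      simpa using ((hr.mul_const u).div_const 2).pow 2
    exact ((((continuous_besselEntire ν).tendsto 0).comp h1).const_mul _).mul_const _

/-! ### Abel moments of the Bessel function -/

theorem exists_tendsto_besselLaplace_self {ν : ℝ} (hν : -1 < 2 * ν) :
    ∃ c, c ≠ 0 ∧ Tendsto (besselLaplace ν ν) (𝓝[>] 0) (𝓝 c) := by
  obtain ⟨c, hc⟩ := exists_besselLaplace_self_eq hν
  obtain ⟨s, hs, hs0⟩ := exists_besselLaplace_self_ne_zero hν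
  refine ⟨c, ?_, ?_⟩
  · rw [← hc s hs]
    exact mul_ne_zero hs0 (by positivity)
  · have h1 : ContinuousAt (fun s : ℝ => c * ((1 + s ^ 2) ^ (ν + 1 / 2))⁻¹) 0 := by
      refine continuousAt_const.mul (ContinuousAt.inv₀ (ContinuousAt.rpow_const ?_ ?_) ?_)
      · fun_prop
      · left; norm_num
      · simp
    have h2 := h1.tendsto.mono_left (nhdsWithin_le_nhds (s := Set.Ioi 0))
    simp only [ne_eq, OfNat.ofNat_ne_zero, not_false_eq_true, zero_pow, add_zero, Real.one_rpow,
      inv_one, mul_one] at h2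
    refine h2.congr' ?_
    filter_upwards [self_mem_nhdsWithin] with t ht
    rw [← hc t ht, mul_assoc, mul_inv_cancel₀ (by positivity), mul_one]

/-- Induction on m with ν free: `besselLaplace_eq` trades (ν, m + 2) for (ν + 1, m) and a term
carrying a factor s, which dies in the limit. Thus ν ≤ -1/2 is reached when m is large enough. -/
theorem exists_tendsto_besselLaplace (m : ℕ) : ∀ ν : ℝ, -1 < 2 * ν + m →
    ∃ c, (Even m → c ≠ 0) ∧ (Odd m → c = 0) ∧
      Tendsto (besselLaplace ν (ν + m)) (𝓝[>] 0) (𝓝 c) := by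
  have hs0 : Tendsto (fun s : ℝ => s) (𝓝[>] 0) (𝓝 0) := nhdsWithin_le_nhds
  induction m using Nat.strong_induction_on with
  | _ m ih =>
    intro ν hν
    match m with
    | 0 =>
      obtain ⟨c, hc, h⟩ := exists_tendsto_besselLaplace_self (ν := ν) (by simpa using hν)
      exact ⟨c, fun _ => hc, fun h => absurd h (by decide), by simpa using h⟩
    | 1 =>
      -- Here the coefficient b - ν - 1 is zero and only the term with the factor s is left, so the
      -- limit is 0.
      obtain ⟨c, -, -, hc⟩ := ih 0 one_pos (ν + 1) (by push_cast at *; linarith)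
      refine ⟨0, fun h => absurd h (by decide), fun _ => rfl, ?_⟩
      have h := hs0.mul hc
      rw [zero_mul] at h
      refine h.congr' ?_
      filter_upwards [self_mem_nhdsWithin] with s hs
      rw [besselLaplace_eq (ν := ν) (by push_cast at *; linarith) hs]
      simp
    | m + 2 =>
      obtain ⟨c, hc0, hc1, hc⟩ := ih m (by omega) (ν + 1) (by push_cast at *; linarith)
      obtain ⟨d, -, -, hd⟩ := ih (m + 1) (by omega) (ν + 1) (by push_cast at *; linarith)
      refine ⟨-((m + 1) * c), fun h => ?_, fun h => ?_, ?_⟩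
      · have := hc0 (by simpa [Nat.even_add] using h)
        have : ((m : ℝ) + 1) ≠ 0 := by positivity
        simp_all
      · rw [hc1 (by simpa [Nat.odd_add] using h)]; simp
      · have h := (hs0.mul hd).sub (hc.const_mul ((m : ℝ) + 1))
        rw [zero_mul, zero_sub] at h
        refine h.congr' ?_
        filter_upwards [self_mem_nhdsWithin] with s hs
        rw [besselLaplace_eq (ν := ν) (by push_cast at *; linarith) hs]
        push_cast
        rw [show ν + ((m : ℝ) + 2) - ν - 1 = m + 1 by ring,
          show ν + 1 + ((m : ℝ) + 1) = ν + (m + 2) by ring,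
          show ν + ((m : ℝ) + 2) - 1 = ν + 1 + m by ring]

open Classical in
/-- The Abel integral of `x ^ (ν + m) J_ν(x)` over `(0, ∞)`. -/
noncomputable def besselAbelMoment (ν : ℝ) (m : ℕ) : ℝ :=
  if h : -1 < 2 * ν + m then (exists_tendsto_besselLaplace m ν h).choose else 0

theorem tendsto_besselLaplace {ν : ℝ} {m : ℕ} (h : -1 < 2 * ν + m) :
    Tendsto (besselLaplace ν (ν + m)) (𝓝[>] 0) (𝓝 (besselAbelMoment ν m)) := by
  rw [besselAbelMoment, dif_pos h]
  exact (exists_tendsto_besselLaplace m ν h).choose_spec.2.2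

theorem besselAbelMoment_ne_zero {ν : ℝ} {m : ℕ} (h : -1 < 2 * ν + m) (hm : Even m) :
    besselAbelMoment ν m ≠ 0 := by
  rw [besselAbelMoment, dif_pos h]
  exact (exists_tendsto_besselLaplace m ν h).choose_spec.1 hm

theorem besselAbelMoment_eq_zero {ν : ℝ} {m : ℕ} (h : -1 < 2 * ν + m) (hm : Odd m) :
    besselAbelMoment ν m = 0 := by
  rw [besselAbelMoment, dif_pos h]
  exact (exists_tendsto_besselLaplace m ν h).choose_spec.2.1 hm

/-- Pass to the limit s → 0+ in both Laplace recurrences, going up to order ν + 1 and back down. -/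
theorem besselAbelMoment_add_two {ν : ℝ} {m : ℕ} (h : -1 < 2 * ν + m) :
    besselAbelMoment ν (m + 2) = -((m + 1) * (2 * ν + m + 1)) * besselAbelMoment ν m := by
  have hs0 : Tendsto (fun s : ℝ => s) (𝓝[>] 0) (𝓝 0) := nhdsWithin_le_nhds
  have t0 := tendsto_besselLaplace h
  have t1 := tendsto_besselLaplace (ν := ν) (m := m + 1) (by push_cast; linarith)
  have t2 := tendsto_besselLaplace (ν := ν) (m := m + 2) (by push_cast; linarith)
  have t3 := tendsto_besselLaplace (ν := ν + 1) (m := m) (by linarith)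
  have t4 := tendsto_besselLaplace (ν := ν + 1) (m := m + 1) (by push_cast; linarith)
  have e1 : besselAbelMoment (ν + 1) m = (2 * ν + m + 1) * besselAbelMoment ν m := by
    have t := (t0.const_mul (2 * ν + m + 1)).sub (hs0.mul t1)
    rw [zero_mul, sub_zero] at t
    refine tendsto_nhds_unique t3 (t.congr' ?_)
    filter_upwards [self_mem_nhdsWithin] with s hs
    rw [besselLaplace_add_one_left (ν := ν) (by linarith) hs]
    push_cast
    rw [show ν + 1 + (m : ℝ) - 1 = ν + m by ring, show ν + ((m : ℝ) + 1) = ν + 1 + m by ring]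
    ring
  have e2 : besselAbelMoment ν (m + 2) = -((m + 1) * besselAbelMoment (ν + 1) m) := by
    have t := (hs0.mul t4).sub (t3.const_mul ((m : ℝ) + 1))
    rw [zero_mul, zero_sub] at t
    refine tendsto_nhds_unique t2 (t.congr' ?_)
    filter_upwards [self_mem_nhdsWithin] with s hs
    rw [besselLaplace_eq (ν := ν) (by push_cast; linarith) hs]
    push_cast
    rw [show ν + ((m : ℝ) + 2) - ν - 1 = m + 1 by ring,
      show ν + 1 + ((m : ℝ) + 1) = ν + (m + 2) by ring,
      show ν + ((m : ℝ) + 2) - 1 = ν + 1 + m by ring]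
  rw [e2, e1]
  ring

/-! ### The Mellin transform of the modified Bessel function -/

theorem exp_abs_div_two_le_cosh (u : ℝ) : Real.exp |u| / 2 ≤ Real.cosh u := by
  rw [← Real.cosh_abs, Real.cosh_eq]
  have := Real.exp_pos (-|u|)
  linarith

theorem cosh_le_exp_abs (u : ℝ) : Real.cosh u ≤ Real.exp |u| := by
  rw [← Real.cosh_abs, Real.cosh_eq]
  have := Real.exp_le_exp.2 (by have := abs_nonneg u; linarith : -|u| ≤ |u|)
  linarith

theorem integrableOn_cosh_mul_cosh_rpow {ν p : ℝ} (hp : |ν| < p) :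
    IntegrableOn (fun u => Real.cosh (ν * u) * Real.cosh u ^ (-p)) (Set.Ioi 0) := by
  have hp0 : 0 < p := (abs_nonneg ν).trans_lt hp
  have hc : Continuous fun u => Real.cosh (ν * u) * Real.cosh u ^ (-p) :=
    (Real.continuous_cosh.comp (by fun_prop)).mul
      (Real.continuous_cosh.rpow_const fun u => Or.inl (Real.cosh_pos u).ne')
  refine Integrable.mono' ((integrableOn_exp_mul_Ioi (a := -(p - |ν|)) (by linarith) 0).const_mul
    (2 ^ p)) hc.aestronglyMeasurable ?_
  filter_upwards [ae_restrict_mem measurableSet_Ioi] with u hu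
  have hu : 0 < u := hu
  rw [Real.norm_eq_abs, abs_of_pos (mul_pos (Real.cosh_pos _)
    (Real.rpow_pos_of_pos (Real.cosh_pos u) _))]
  have h1 : Real.cosh (ν * u) ≤ Real.exp (|ν| * u) := by
    simpa [abs_mul, abs_of_pos hu] using cosh_le_exp_abs (ν * u)
  have h2 : Real.cosh u ^ (-p) ≤ (Real.exp u / 2) ^ (-p) := by
    refine Real.rpow_le_rpow_of_nonpos (by positivity) ?_ (by linarith)
    simpa [abs_of_pos hu] using exp_abs_div_two_le_cosh u
  calc _ ≤ Real.exp (|ν| * u) * (Real.exp u / 2) ^ (-p) := by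
        have := Real.cosh_pos u
        gcongr
    _ = _ := by
      rw [Real.div_rpow (Real.exp_pos _).le zero_le_two, ← Real.exp_mul, Real.rpow_neg zero_le_two,
        div_inv_eq_mul, ← mul_assoc, ← Real.exp_add, mul_comm]
      ring_nf

/-- The integral `∫_0^∞ cosh (ν u) (cosh u) ^ (-p) du`. -/
noncomputable def coshIntegral (ν p : ℝ) : ℝ :=
  ∫ u in Set.Ioi (0 : ℝ), Real.cosh (ν * u) * Real.cosh u ^ (-p)

/-- The function H is the Wronskian g' f - g f' of f = cosh^(-p) and g(u) = cosh(νu), so H' = g'' f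
- g f'' is the combination in question. H vanishes at 0 and at infinity. -/
theorem coshIntegral_add_two {ν p : ℝ} (hp : |ν| < p) :
    p * (p + 1) * coshIntegral ν (p + 2) = (p ^ 2 - ν ^ 2) * coshIntegral ν p := by
  have hp0 : 0 < p := (abs_nonneg ν).trans_lt hp
  set H : ℝ → ℝ := fun u => ν * (Real.sinh (ν * u) * Real.cosh u ^ (-p)) +
    p * (Real.cosh (ν * u) * (Real.sinh u * Real.cosh u ^ (-p - 1))) with hH
  set H' : ℝ → ℝ := fun u => p * (p + 1) * (Real.cosh (ν * u) * Real.cosh u ^ (-(p + 2))) -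
    (p ^ 2 - ν ^ 2) * (Real.cosh (ν * u) * Real.cosh u ^ (-p)) with hH'
  have i1 := integrableOn_cosh_mul_cosh_rpow hp
  have i2 := integrableOn_cosh_mul_cosh_rpow (hp.trans (lt_add_of_pos_right p two_pos))
  have hd : ∀ u, HasDerivAt H (H' u) u := by
    intro u
    have hc := Real.cosh_pos u
    have hν : HasDerivAt (fun u => ν * u) ν u := by simpa using (hasDerivAt_id u).const_mul ν
    have hr (q : ℝ) := (Real.hasDerivAt_cosh u).rpow_const (p := q) (Or.inl hc.ne')
    refine (((hν.sinh.mul (hr (-p))).const_mul ν).add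
      ((hν.cosh.mul ((Real.hasDerivAt_sinh u).mul (hr (-p - 1)))).const_mul p)).congr_deriv ?_
    simp only [hH', Pi.mul_apply]
    rw [show -(p + 2) = -p - 1 - 1 by ring, Real.rpow_sub_one hc.ne' (-p - 1),
      Real.rpow_sub_one hc.ne' (-p)]
    have hs := Real.sinh_sq u
    field_simp
    ring_nf
    rw [hs]
    ring
  have iH' : IntegrableOn H' (Set.Ioi 0) := (i2.const_mul _).sub (i1.const_mul _)
  have iH : IntegrableOn H (Set.Ioi 0) := by
    refine Integrable.mono' (i1.const_mul (|ν| + p))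
      (continuous_iff_continuousAt.2 fun u => (hd u).continuousAt).aestronglyMeasurable ?_
    filter_upwards with u
    have hc := Real.cosh_pos u
    have hs (v : ℝ) : |Real.sinh v| ≤ Real.cosh v := by
      rw [Real.abs_sinh, ← Real.cosh_abs]
      exact (Real.sinh_lt_cosh _).le
    have e : Real.cosh u * Real.cosh u ^ (-p - 1) = Real.cosh u ^ (-p) := by
      rw [Real.rpow_sub_one hc.ne']
      field_simp
    calc ‖H u‖ ≤ |ν| * (|Real.sinh (ν * u)| * Real.cosh u ^ (-p)) +
          p * (Real.cosh (ν * u) * (|Real.sinh u| * Real.cosh u ^ (-p - 1))) := by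
          refine (norm_add_le _ _).trans (le_of_eq ?_)
          simp only [Real.norm_eq_abs, abs_mul, abs_of_pos hp0, abs_of_pos (Real.cosh_pos _),
            abs_of_pos (Real.rpow_pos_of_pos hc _)]
      _ ≤ |ν| * (Real.cosh (ν * u) * Real.cosh u ^ (-p)) +
          p * (Real.cosh (ν * u) * (Real.cosh u * Real.cosh u ^ (-p - 1))) := by
          gcongr
          · exact hs _
          · exact hs _
      _ = _ := by rw [e]; ring
  have h := integral_Ioi_of_hasDerivAt_of_tendsto' (fun u _ => hd u) iH'
    (tendsto_zero_of_hasDerivAt_of_integrableOn_Ioi (fun u _ => hd u) iH' iH)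
  have h0 : H 0 = 0 := by simp [hH]
  rw [h0, hH', integral_sub (i2.const_mul _) (i1.const_mul _), integral_const_mul,
    integral_const_mul, sub_zero] at h
  exact sub_eq_zero.1 h

theorem integrable_besselK_integrand (ν : ℝ) {x : ℝ} (hx : 0 < x) :
    IntegrableOn (fun t => Real.exp (-x * Real.cosh t) * Real.cosh (ν * t)) (Set.Ioi 0) := by
  -- The bound exp(-y) ≤ n! / y^n at y = x cosh t leaves an integrable cosh^(-n) as soon as n > |ν|.
  obtain ⟨n, hn⟩ := exists_nat_gt |ν|
  refine Integrable.mono' ((integrableOn_cosh_mul_cosh_rpow hn).const_mul (n.factorial / x ^ n))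
    (Continuous.aestronglyMeasurable ?_) ?_
  · exact (Real.continuous_exp.comp (continuous_const.mul Real.continuous_cosh)).mul
      (Real.continuous_cosh.comp (by fun_prop))
  · filter_upwards with t
    have hc := Real.cosh_pos t
    have hc' := Real.cosh_pos (ν * t)
    have h1 := Real.pow_div_factorial_le_exp (x * Real.cosh t) (by positivity) n
    have h2 : Real.exp (-x * Real.cosh t) ≤ n.factorial / x ^ n * Real.cosh t ^ (-(n : ℝ)) := by
      rw [neg_mul, Real.exp_neg, Real.rpow_neg hc.le, Real.rpow_natCast]
      refine (inv_anti₀ (by positivity) h1).trans (le_of_eq ?_)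
      rw [mul_pow]
      field_simp
    rw [Real.norm_eq_abs, abs_of_pos (by positivity)]
    calc _ ≤ n.factorial / x ^ n * Real.cosh t ^ (-(n : ℝ)) * Real.cosh (ν * t) := by gcongr
      _ = _ := by ring

theorem besselK_pos (ν : ℝ) {x : ℝ} (hx : 0 < x) : 0 < besselK ν x := by
  rw [besselK, setIntegral_pos_iff_support_of_nonneg_ae
    (Eventually.of_forall fun t => (mul_pos (Real.exp_pos _) (Real.cosh_pos _)).le)
    (integrable_besselK_integrand ν hx)]
  have : Function.support (fun t => Real.exp (-x * Real.cosh t) * Real.cosh (ν * t)) = Set.univ :=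
    Set.eq_univ_of_forall fun t => (mul_pos (Real.exp_pos _) (Real.cosh_pos _)).ne'
  rw [this]
  simp

/-- Tonelli–Fubini: for fixed t the x-integral is a Gamma integral equal to Γ(p) (cosh t)^(-p)
cosh(νt). -/
theorem integrableOn_rpow_mul_besselK_and_integral_eq {ν p : ℝ} (hp : |ν| < p) :
    IntegrableOn (fun x => x ^ (p - 1) * besselK ν x) (Set.Ioi 0) ∧
    ∫ x in Set.Ioi (0 : ℝ), x ^ (p - 1) * besselK ν x = Real.Gamma p * coshIntegral ν p := by
  have hp0 : 0 < p := (abs_nonneg ν).trans_lt hp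
  set f : ℝ → ℝ → ℝ := fun x t =>
    x ^ (p - 1) * (Real.exp (-x * Real.cosh t) * Real.cosh (ν * t)) with hf
  have hfx : ∀ t, ∫ x in Set.Ioi (0 : ℝ), f x t =
      Real.Gamma p * (Real.cosh (ν * t) * Real.cosh t ^ (-p)) := by
    intro t
    have h := Real.integral_rpow_mul_exp_neg_mul_Ioi hp0 (Real.cosh_pos t)
    rw [one_div, Real.inv_rpow (Real.cosh_pos t).le, ← Real.rpow_neg (Real.cosh_pos t).le] at h
    rw [mul_left_comm, mul_comm (Real.Gamma p), ← h, ← integral_const_mul]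
    refine integral_congr_ae (Eventually.of_forall fun x => ?_)
    simp only [hf]
    rw [neg_mul, mul_comm x (Real.cosh t)]
    ring
  have hfi : ∀ t, IntegrableOn (fun x => f x t) (Set.Ioi 0) := by
    intro t
    refine IntegrableOn.congr_fun ((integrableOn_rpow_mul_exp_neg_mul (b := p - 1) (by linarith)
      (Real.cosh_pos t)).mul_const (Real.cosh (ν * t))) (fun x _ => ?_) measurableSet_Ioi
    simp only [hf]
    rw [show -x * Real.cosh t = -Real.cosh t * x by ring]
    ring
  have hmeas : AEStronglyMeasurable (Function.uncurry f)
      ((volume.restrict (Set.Ioi (0 : ℝ))).prod (volume.restrict (Set.Ioi (0 : ℝ)))) := by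
    refine Measurable.aestronglyMeasurable ?_
    refine (measurable_fst.pow_const _).mul (Measurable.mul ?_ ?_)
    · exact Real.measurable_exp.comp
        (measurable_fst.neg.mul (Real.measurable_cosh.comp measurable_snd))
    · exact Real.measurable_cosh.comp (measurable_snd.const_mul ν)
  have hint : Integrable (Function.uncurry f)
      ((volume.restrict (Set.Ioi (0 : ℝ))).prod (volume.restrict (Set.Ioi (0 : ℝ)))) := by
    rw [integrable_prod_iff' hmeas]
    refine ⟨Eventually.of_forall hfi, ?_⟩
    refine ((integrableOn_cosh_mul_cosh_rpow hp).const_mul (Real.Gamma p)).congr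
      (Eventually.of_forall fun t => ?_)
    simp only
    rw [← hfx]
    refine setIntegral_congr_fun measurableSet_Ioi fun x hx => ?_
    have hx : 0 < x := hx
    have := Real.cosh_pos (ν * t)
    simp only [Function.uncurry, hf]
    rw [Real.norm_eq_abs, abs_of_nonneg (by positivity)]
  have hK : ∀ x, ∫ t in Set.Ioi (0 : ℝ), f x t = x ^ (p - 1) * besselK ν x := fun x => by
    rw [besselK, ← integral_const_mul]
  refine ⟨?_, ?_⟩
  · have := hint.integral_prod_left
    simp only [Function.uncurry] at this
    exact this.congr (Eventually.of_forall hK)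
  · simp only [← hK]
    rw [integral_integral_swap hint]
    simp only [hfx]
    rw [integral_const_mul, coshIntegral]

theorem integral_rpow_mul_besselK_add_two {ν p : ℝ} (hp : |ν| < p) :
    ∫ x in Set.Ioi (0 : ℝ), x ^ (p + 2 - 1) * besselK ν x =
      (p ^ 2 - ν ^ 2) * ∫ x in Set.Ioi (0 : ℝ), x ^ (p - 1) * besselK ν x := by
  have hp0 : 0 < p := (abs_nonneg ν).trans_lt hp
  rw [(integrableOn_rpow_mul_besselK_and_integral_eq hp).2,
    (integrableOn_rpow_mul_besselK_and_integral_eq (hp.trans (lt_add_of_pos_right p two_pos))).2,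
    show p + 2 = p + 1 + 1 by ring, Real.Gamma_add_one (by positivity),
    Real.Gamma_add_one hp0.ne', show p + 1 + 1 = p + 2 by ring]
  linear_combination Real.Gamma p * coshIntegral_add_two hp

/-! ### Moments of the Prudnikov weight -/

/-- Writing the exponent with m mod 2 treats both parities at once. -/
theorem prudnikovWeight_eq {μ ν : ℝ} {m : ℕ} (hm : μ - ν = m) (x : ℝ) :
    prudnikovWeight μ ν x =
      besselK ν (Real.sqrt x) / 2 * x ^ ((μ - 1 + (m % 2 : ℕ)) / 2) := by
  have h : (∃ j : ℕ, μ - ν = 2 * (j : ℝ)) ↔ Even m := by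
    rw [hm, even_iff_exists_two_mul]
    exact exists_congr fun j => by exact_mod_cast Iff.rfl
  rw [prudnikovWeight]
  rcases Nat.even_or_odd m with he | ho
  · rw [if_pos (h.2 he), Nat.even_iff.1 he]
    simp
  · rw [if_neg (h.not.2 (Nat.not_even_iff_odd.2 ho)), Nat.odd_iff.1 ho]
    simp

theorem prudnikovWeight_pos {μ ν : ℝ} {m : ℕ} (hm : μ - ν = m) {x : ℝ} (hx : 0 < x) :
    0 < prudnikovWeight μ ν x := by
  rw [prudnikovWeight_eq hm]
  have := besselK_pos ν (Real.sqrt_pos.2 hx)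
  positivity

/-- The moments of the Prudnikov weight. -/
noncomputable def prudnikovMoment (μ ν : ℝ) (i : ℕ) : ℝ :=
  ∫ x in Set.Ioi (0 : ℝ), prudnikovWeight μ ν x * x ^ i

theorem prudnikovWeight_mul_pow_comp_sq {μ ν : ℝ} {m : ℕ} (hm : μ - ν = m) (i : ℕ) {x : ℝ}
    (hx : 0 < x) : (2 * x ^ ((2 : ℝ) - 1)) •
      (prudnikovWeight μ ν (x ^ (2 : ℝ)) * (x ^ (2 : ℝ)) ^ i) =
      x ^ (μ + 1 + (m % 2 : ℕ) + 2 * i - 1) * besselK ν x := by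
  rw [prudnikovWeight_eq hm, Real.rpow_two, Real.sqrt_sq hx.le, ← Real.rpow_two,
    ← Real.rpow_mul hx.le, ← Real.rpow_natCast, ← Real.rpow_mul hx.le, smul_eq_mul,
    show μ + 1 + ((m % 2 : ℕ) : ℝ) + 2 * i - 1 =
      (2 - 1) + (2 * ((μ - 1 + ((m % 2 : ℕ) : ℝ)) / 2) + 2 * i) by ring,
    Real.rpow_add hx, Real.rpow_add hx]
  ring

section

variable {μ ν : ℝ} {m : ℕ}

theorem abs_lt_add_of_sub_eq (hμν : -1 < μ + ν) (hm : μ - ν = m) (i : ℕ) :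
    |ν| < μ + 1 + (m % 2 : ℕ) + 2 * i := by
  have h1 : (0 : ℝ) ≤ (m % 2 : ℕ) := Nat.cast_nonneg _
  have h2 : (0 : ℝ) ≤ i := Nat.cast_nonneg _
  have h3 : (0 : ℝ) ≤ m := Nat.cast_nonneg _
  rw [abs_lt]
  constructor <;> linarith

theorem integrableOn_prudnikovWeight_mul_pow (hμν : -1 < μ + ν) (hm : μ - ν = m) (i : ℕ) :
    IntegrableOn (fun x => prudnikovWeight μ ν x * x ^ i) (Set.Ioi 0) := by
  rw [← integrableOn_Ioi_comp_rpow_iff _ (two_ne_zero (α := ℝ)), abs_two]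
  exact IntegrableOn.congr_fun (integrableOn_rpow_mul_besselK_and_integral_eq
    (abs_lt_add_of_sub_eq hμν hm i)).1
    (fun x hx => (prudnikovWeight_mul_pow_comp_sq hm i hx).symm) measurableSet_Ioi

theorem prudnikovMoment_eq (hm : μ - ν = m) (i : ℕ) :
    prudnikovMoment μ ν i =
      ∫ x in Set.Ioi (0 : ℝ), x ^ (μ + 1 + (m % 2 : ℕ) + 2 * i - 1) * besselK ν x := by
  rw [prudnikovMoment, ← integral_comp_rpow_Ioi_of_pos two_pos]
  exact setIntegral_congr_fun measurableSet_Ioi fun x hx =>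
    prudnikovWeight_mul_pow_comp_sq hm i hx

theorem prudnikovMoment_succ (hμν : -1 < μ + ν) (hm : μ - ν = m) (i : ℕ) :
    prudnikovMoment μ ν (i + 1) = (m + (2 * i + (m % 2 : ℕ)) + 1) *
      (2 * ν + m + (2 * i + (m % 2 : ℕ)) + 1) * prudnikovMoment μ ν i := by
  rw [prudnikovMoment_eq hm, prudnikovMoment_eq hm]
  have h := integral_rpow_mul_besselK_add_two (abs_lt_add_of_sub_eq hμν hm i)
  rw [show μ + 1 + ((m % 2 : ℕ) : ℝ) + 2 * ((i + 1 : ℕ) : ℝ) - 1 =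
    μ + 1 + ((m % 2 : ℕ) : ℝ) + 2 * i + 2 - 1 by push_cast; ring, h]
  congr 1
  rw [show μ = ν + m by linarith]
  ring

theorem prudnikovMoment_zero_pos (hμν : -1 < μ + ν) (hm : μ - ν = m) :
    0 < prudnikovMoment μ ν 0 := by
  rw [prudnikovMoment, setIntegral_pos_iff_support_of_nonneg_ae _
    (integrableOn_prudnikovWeight_mul_pow hμν hm 0)]
  · refine lt_of_lt_of_le ?_ (measure_mono (s := Set.Ioi (0 : ℝ)) fun x hx => ⟨?_, hx⟩)
    · simp
    · simpa using (prudnikovWeight_pos hm hx).ne'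
  · filter_upwards [ae_restrict_mem measurableSet_Ioi] with x hx
    simpa using (prudnikovWeight_pos hm hx).le

/-- With p = μ + 1 + r + 2i, r = m mod 2, the Mellin factor p² - ν² = (p - ν)(p + ν) is the negative
of the Abel factor. Both sequences thus agree up to (-1)^i and the ratio of their initial values,
which is nonzero because m + r is even. -/
theorem besselAbelMoment_eq_prudnikovMoment (hμν : -1 < μ + ν) (hm : μ - ν = m) :
    ∃ c, c ≠ 0 ∧ ∀ i : ℕ, besselAbelMoment ν (m + (2 * i + m % 2)) =
      c * ((-1) ^ i * prudnikovMoment μ ν i) := by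
  have h0 := prudnikovMoment_zero_pos hμν hm
  have hν (j : ℕ) : -1 < 2 * ν + (m + j : ℕ) := by
    have : (0 : ℝ) ≤ j := Nat.cast_nonneg _
    push_cast
    linarith
  have heven : Even (m + (2 * 0 + m % 2)) := by rw [Nat.even_iff]; omega
  refine ⟨besselAbelMoment ν (m + (2 * 0 + m % 2)) / prudnikovMoment μ ν 0,
    div_ne_zero (besselAbelMoment_ne_zero (hν _) heven) h0.ne', fun i => ?_⟩
  induction i with
  | zero => field_simp
  | succ i ih =>
    rw [show m + (2 * (i + 1) + m % 2) = m + (2 * i + m % 2) + 2 by ring,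
      besselAbelMoment_add_two (hν _), ih, prudnikovMoment_succ hμν hm, pow_succ]
    push_cast
    ring

end

/-! ### Orthogonal polynomials for a functional -/

/-- The linear functional on polynomials with the moments `c i`. -/
noncomputable def momentFunctional (c : ℕ → ℝ) : ℝ[X] →ₗ[ℝ] ℝ :=
  Polynomial.lsum fun i => c i • LinearMap.id

@[simp]
theorem momentFunctional_monomial (c : ℕ → ℝ) (i : ℕ) (a : ℝ) :
    momentFunctional c (monomial i a) = c i * a := by
  simp [momentFunctional, Polynomial.lsum_apply]

/-- `p` is a monic polynomial of degree `n` whose products with the polynomials of smaller degree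
are annihilated by the functional `L`. -/
structure IsMonicOrthogonal (L : ℝ[X] →ₗ[ℝ] ℝ) (n : ℕ) (p : ℝ[X]) : Prop where
  monic : p.Monic
  natDegree_eq : p.natDegree = n
  orthogonal : ∀ q : ℝ[X], q.degree < n → L (p * q) = 0

theorem map_mul_eq_zero_of_forall_X_pow {L : ℝ[X] →ₗ[ℝ] ℝ} {n : ℕ} {p : ℝ[X]}
    (h : ∀ k < n, L (p * X ^ k) = 0) {q : ℝ[X]} (hq : q.degree < n) : L (p * q) = 0 := by
  rw [← mem_degreeLT, degreeLT_eq_span_X_pow] at hq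
  induction hq using Submodule.span_induction with
  | mem x hx =>
    simp only [Finset.coe_image, Finset.coe_range, Set.mem_image, Set.mem_Iio] at hx
    obtain ⟨k, hk, rfl⟩ := hx
    exact h k hk
  | zero => simp
  | add x y _ _ hx hy => rw [mul_add, map_add, hx, hy, add_zero]
  | smul a x _ hx => rw [mul_smul_comm, map_smul, hx, smul_zero]

theorem degree_sub_lt_of_monic {n : ℕ} {p q : ℝ[X]} (hp : p.Monic) (hq : q.Monic)
    (hpn : p.natDegree = n) (hqn : q.natDegree = n) : (p - q).degree < n := by
  rw [← hpn, ← degree_eq_natDegree hp.ne_zero]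
  refine degree_sub_lt_left ?_ hp.ne_zero (by rw [hp.leadingCoeff, hq.leadingCoeff])
  rw [degree_eq_natDegree hp.ne_zero, degree_eq_natDegree hq.ne_zero, hpn, hqn]

section PositiveDefinite

variable {L : ℝ[X] →ₗ[ℝ] ℝ}

/-- Subtract from X^n its orthogonal projection r onto degree < n; r exists because a definite form
on a finite-dimensional space represents every functional. -/
theorem exists_isMonicOrthogonal (hL : ∀ p : ℝ[X], p ≠ 0 → 0 < L (p * p)) (n : ℕ) :
    ∃ p, IsMonicOrthogonal L n p := by
  set T := ((LinearMap.mul ℝ ℝ[X]).compr₂ L).domRestrict₁₂ (degreeLT ℝ n) (degreeLT ℝ n) with hT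
  have hinj : Function.Injective T := by
    rw [injective_iff_map_eq_zero]
    intro r hr
    by_contra h0
    have h1 : (r : ℝ[X]) ≠ 0 := fun h => h0 (Subtype.ext h)
    have h2 : T r r = L (r * r) := rfl
    rw [hr] at h2
    exact (hL r h1).ne h2
  obtain ⟨r, hr⟩ := (LinearMap.injective_iff_surjective_of_finrank_eq_finrank
    (Subspace.dual_finrank_eq (K := ℝ) (V := degreeLT ℝ n)).symm).1 hinj
    (((LinearMap.mul ℝ ℝ[X]).compr₂ L (X ^ n)).domRestrict (degreeLT ℝ n))
  have hrn : (r : ℝ[X]).degree < n := mem_degreeLT.1 r.2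
  refine ⟨X ^ n - (r : ℝ[X]), monic_X_pow_sub hrn, ?_, fun q hq => ?_⟩
  · refine natDegree_eq_of_degree_eq_some ?_
    rw [degree_sub_eq_left_of_degree_lt (by rwa [degree_X_pow]), degree_X_pow]
  · have h : L (r * q) = L (X ^ n * q) := LinearMap.congr_fun hr ⟨q, mem_degreeLT.2 hq⟩
    rw [sub_mul, map_sub, h, sub_self]

theorem IsMonicOrthogonal.unique (hL : ∀ p : ℝ[X], p ≠ 0 → 0 < L (p * p)) {n : ℕ} {p q : ℝ[X]}
    (hp : IsMonicOrthogonal L n p) (hq : IsMonicOrthogonal L n q) : p = q := by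
  have hd := degree_sub_lt_of_monic hp.monic hq.monic hp.natDegree_eq hq.natDegree_eq
  by_contra h
  have h1 := hL (p - q) (sub_ne_zero.2 h)
  rw [sub_mul, map_sub, hp.orthogonal _ hd, hq.orthogonal _ hd, sub_zero] at h1
  exact lt_irrefl _ h1

/-- If p = X q, then q has smaller degree and L(p q) = L(X q²) would be both 0 and positive. -/
theorem IsMonicOrthogonal.eval_zero_ne_zero (hX : ∀ p : ℝ[X], p ≠ 0 → 0 < L (X * (p * p)))
    {n : ℕ} {p : ℝ[X]} (hp : IsMonicOrthogonal L n p) : p.eval 0 ≠ 0 := by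
  intro h
  obtain ⟨q, rfl⟩ := X_dvd_iff.2 ((coeff_zero_eq_eval_zero p).trans h)
  have hq : q ≠ 0 := by
    rintro rfl
    exact hp.monic.ne_zero (mul_zero X)
  refine (hX q hq).ne' ?_
  rw [← mul_assoc]
  refine hp.orthogonal q ?_
  rw [← hp.natDegree_eq, natDegree_X_mul hq, degree_eq_natDegree hq]
  exact_mod_cast Nat.lt_succ_self _

end PositiveDefinite

/-! ### Even and odd parts -/

/-- Substituting -X² rather than X² absorbs the signs (-1)^i of the moments. The nonvanishing
condition on B matters: for B = 0 its degree bound fails when D is constant. -/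
theorem exists_comp_neg_sq_add_X_mul (D : ℝ[X]) : ∃ A B : ℝ[X],
    D = A.comp (-X ^ 2) + X * B.comp (-X ^ 2) ∧
    (A ≠ 0 → 2 * A.natDegree ≤ D.natDegree) ∧ (B ≠ 0 → 2 * B.natDegree + 1 ≤ D.natDegree) := by
  have hcomp (p : ℝ[X]) : (p.comp (-X)).comp (-X ^ 2) = expand ℝ 2 p := by
    rw [comp_assoc, expand_eq_comp_X_pow]
    simp
  have hdeg (p : ℝ[X]) : (p.comp (-X)).natDegree = p.natDegree := by
    rw [natDegree_comp]
    simp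
  refine ⟨(contract 2 D).comp (-X), (contract 2 D.divX).comp (-X), ?_, fun h => ?_, fun h => ?_⟩
  · rw [hcomp, hcomp]
    ext k
    rw [coeff_add, coeff_expand two_pos]
    rcases k with _ | k
    · simp [coeff_contract]
    · rw [coeff_X_mul, coeff_expand two_pos]
      rcases Nat.even_or_odd k with hk | hk
      · have h1 : 2 ∣ k := hk.two_dvd
        have h2 : ¬ 2 ∣ k + 1 := by omega
        rw [if_pos h1, if_neg h2, coeff_contract two_ne_zero, coeff_divX, Nat.div_mul_cancel h1,
          zero_add]
      · have h1 : ¬ 2 ∣ k := hk.not_two_dvd_nat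
        have h2 : 2 ∣ k + 1 := by omega
        rw [if_neg h1, if_pos h2, coeff_contract two_ne_zero, Nat.div_mul_cancel h2, add_zero]
  · rw [hdeg]
    refine le_natDegree_of_ne_zero ?_
    rw [mul_comm, ← coeff_contract two_ne_zero]
    exact leadingCoeff_ne_zero.2 (comp_neg_X_eq_zero_iff.not.1 h)
  · rw [hdeg]
    refine le_natDegree_of_ne_zero ?_
    rw [mul_comm, ← coeff_divX, ← coeff_contract two_ne_zero]
    exact leadingCoeff_ne_zero.2 (comp_neg_X_eq_zero_iff.not.1 h)

theorem natDegree_comp_neg_sq (p : ℝ[X]) : (p.comp (-X ^ 2)).natDegree = 2 * p.natDegree := by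
  rw [natDegree_comp, natDegree_neg, natDegree_X_pow, mul_comm]

theorem degree_comp_neg_sq_lt {p : ℝ[X]} {N : ℕ} (h : 2 * p.natDegree < N) :
    (p.comp (-X ^ 2)).degree < N := by
  refine degree_le_natDegree.trans_lt ?_
  rw [natDegree_comp_neg_sq]
  exact_mod_cast h

theorem degree_X_mul_comp_neg_sq_lt {p : ℝ[X]} {N : ℕ} (h : 2 * p.natDegree + 1 < N) :
    ((X : ℝ[X]) * p.comp (-X ^ 2)).degree < N := by
  refine degree_le_natDegree.trans_lt ?_
  have h1 := natDegree_mul_le (p := (X : ℝ[X])) (q := p.comp (-X ^ 2))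
  rw [natDegree_comp_neg_sq, natDegree_X] at h1
  exact_mod_cast (by omega : (X * p.comp (-X ^ 2)).natDegree < N)

theorem monic_neg_one_pow_mul_comp_neg_sq {p : ℝ[X]} {n : ℕ} (hp : p.Monic)
    (hn : p.natDegree = n) : (C ((-1) ^ n) * p.comp (-X ^ 2)).Monic ∧
      (C ((-1) ^ n) * p.comp (-X ^ 2)).natDegree = 2 * n := by
  constructor
  · rw [Monic, leadingCoeff_mul, leadingCoeff_C, leadingCoeff_comp (by simp), hp.leadingCoeff, hn,
      leadingCoeff_neg, leadingCoeff_X_pow, one_mul, ← mul_pow]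
    simp
  · rw [natDegree_C_mul (by simp), natDegree_comp_neg_sq, hn]

section Functional

variable {L B : ℝ[X] →ₗ[ℝ] ℝ} {c : ℝ}

theorem map_X_sq_mul_comp_neg_sq (hB : ∀ p : ℝ[X], B (p.comp (-X ^ 2)) = c * L p) (p : ℝ[X]) :
    B (X * (X * p.comp (-X ^ 2))) = -(c * L (X * p)) := by
  rw [← hB, ← map_neg]
  congr 1
  rw [mul_comp, X_comp]
  ring

/-- Nondegeneracy of B below degree N: testing D against its own even part gives c L(P²) = 0, and
then against its odd part -c L(X Q²) = 0. -/
theorem eq_zero_of_orthogonal_of_even (hc : c ≠ 0) (hL : ∀ p : ℝ[X], p ≠ 0 → 0 < L (p * p))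
    (hX : ∀ p : ℝ[X], p ≠ 0 → 0 < L (X * (p * p)))
    (hB : ∀ p : ℝ[X], B (p.comp (-X ^ 2)) = c * L p)
    (hB' : ∀ p : ℝ[X], B (X * p.comp (-X ^ 2)) = 0) {N : ℕ} {D : ℝ[X]} (hD : D.degree < N)
    (h : ∀ k < N, B (D * X ^ k) = 0) : D = 0 := by
  by_contra hD0
  have hDN : D.natDegree < N := (natDegree_lt_iff_degree_lt hD0).2 hD
  obtain ⟨P, Q, rfl, hP, hQ⟩ := exists_comp_neg_sq_add_X_mul D
  have hP0 : P = 0 := by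
    by_contra h0
    have h1 := map_mul_eq_zero_of_forall_X_pow h
      (degree_comp_neg_sq_lt ((hP h0).trans_lt hDN))
    rw [add_mul, map_add, mul_assoc, ← mul_comp, ← mul_comp, hB, hB', add_zero] at h1
    exact mul_ne_zero hc (hL P h0).ne' h1
  have hQ0 : Q = 0 := by
    by_contra h0
    have h1 := map_mul_eq_zero_of_forall_X_pow h
      (degree_X_mul_comp_neg_sq_lt ((hQ h0).trans_lt hDN))
    rw [hP0, zero_comp, zero_add, mul_assoc, mul_left_comm (Q.comp _), ← mul_comp,
      map_X_sq_mul_comp_neg_sq hB] at h1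
    exact mul_ne_zero hc (hX Q h0).ne' (neg_eq_zero.1 h1)
  exact hD0 (by simp [hP0, hQ0])

/-- If the odd part is X Q(-X²), testing against Q(-X²) gives c L(Q²) = 0. The test polynomial has
one degree less than the odd part, so D itself may have degree N. -/
theorem eq_comp_neg_sq_of_orthogonal_of_odd (hc : c ≠ 0)
    (hL : ∀ p : ℝ[X], p ≠ 0 → 0 < L (p * p))
    (hB : ∀ p : ℝ[X], B (X * p.comp (-X ^ 2)) = c * L p)
    (hB' : ∀ p : ℝ[X], B (p.comp (-X ^ 2)) = 0) {N : ℕ} {D : ℝ[X]} (hD : D.degree < (N + 1 : ℕ))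
    (h : ∀ k < N, B (D * X ^ k) = 0) : ∃ P : ℝ[X], D = P.comp (-X ^ 2) := by
  rcases eq_or_ne D 0 with rfl | hD0
  · exact ⟨0, by simp⟩
  have hDN : D.natDegree < N + 1 := (natDegree_lt_iff_degree_lt hD0).2 hD
  obtain ⟨P, Q, rfl, hP, hQ⟩ := exists_comp_neg_sq_add_X_mul D
  have hQ0 : Q = 0 := by
    by_contra h0
    have h1 := map_mul_eq_zero_of_forall_X_pow h (degree_comp_neg_sq_lt (p := Q) (by
      have := hQ h0
      omega))
    rw [add_mul, map_add, mul_assoc, ← mul_comp, ← mul_comp, hB, hB', zero_add] at h1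
    exact mul_ne_zero hc (hL Q h0).ne' h1
  exact ⟨P, by simp [hQ0]⟩

/-- Now D = P(-X²) has even degree, hence at most 2n - 2, and X P(-X²) is still an admissible test
polynomial. -/
theorem eq_zero_of_orthogonal_of_odd (hc : c ≠ 0) (hL : ∀ p : ℝ[X], p ≠ 0 → 0 < L (p * p))
    (hB : ∀ p : ℝ[X], B (X * p.comp (-X ^ 2)) = c * L p)
    (hB' : ∀ p : ℝ[X], B (p.comp (-X ^ 2)) = 0) {n : ℕ} {D : ℝ[X]} (hD : D.degree < (2 * n : ℕ))
    (h : ∀ k < 2 * n, B (D * X ^ k) = 0) : D = 0 := by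
  obtain ⟨P, rfl⟩ := eq_comp_neg_sq_of_orthogonal_of_odd hc hL hB hB'
    (hD.trans (by exact_mod_cast Nat.lt_succ_self _)) h
  by_contra hD0
  have hDN := (natDegree_lt_iff_degree_lt hD0).2 hD
  rw [natDegree_comp_neg_sq] at hDN
  have hP0 : P ≠ 0 := by
    rintro rfl
    simp at hD0
  have h1 := map_mul_eq_zero_of_forall_X_pow h (degree_X_mul_comp_neg_sq_lt (p := P) (by omega))
  rw [mul_left_comm, ← mul_comp, hB] at h1
  exact mul_ne_zero hc (hL P hP0).ne' h1

theorem comp_neg_sq_mul_X_pow_two_mul (p : ℝ[X]) (i : ℕ) :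
    p.comp (-X ^ 2) * X ^ (2 * i) = C ((-1) ^ i) * (p * X ^ i).comp (-X ^ 2) := by
  rw [mul_comp, X_pow_comp, neg_pow (X ^ 2 : ℝ[X]) i, pow_mul, C_pow, C_neg, C_1]
  have : ((-1 : ℝ[X]) ^ i) * (-1) ^ i = 1 := by rw [← mul_pow]; simp
  linear_combination -(p.comp (-X ^ 2) * (X ^ 2) ^ i) * this

theorem isMonicOrthogonal_comp_neg_sq
    (hB : (∀ p : ℝ[X], B (p.comp (-X ^ 2)) = c * L p ∧ B (X * p.comp (-X ^ 2)) = 0) ∨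
      ∀ p : ℝ[X], B (X * p.comp (-X ^ 2)) = c * L p ∧ B (p.comp (-X ^ 2)) = 0)
    {n : ℕ} {p : ℝ[X]} (hp : IsMonicOrthogonal L n p) :
    IsMonicOrthogonal B (2 * n) (C ((-1) ^ n) * p.comp (-X ^ 2)) := by
  obtain ⟨h1, h2⟩ := monic_neg_one_pow_mul_comp_neg_sq hp.monic hp.natDegree_eq
  refine ⟨h1, h2, fun q hq => map_mul_eq_zero_of_forall_X_pow (fun k hk => ?_) hq⟩
  have hi (i : ℕ) (hi : i < n) : L (p * X ^ i) = 0 :=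
    hp.orthogonal _ (by rw [degree_X_pow]; exact_mod_cast hi)
  rw [mul_assoc, ← smul_eq_C_mul, map_smul, smul_eq_mul]
  rcases Nat.even_or_odd' k with ⟨i, rfl | rfl⟩
  · rw [comp_neg_sq_mul_X_pow_two_mul, ← smul_eq_C_mul, map_smul]
    rcases hB with hB | hB
    · rw [(hB _).1, hi i (by omega)]; simp
    · rw [(hB _).2]; simp
  · rw [pow_succ' X (2 * i), mul_left_comm, comp_neg_sq_mul_X_pow_two_mul, mul_left_comm, ← smul_eq_C_mul,
      map_smul]
    rcases hB with hB | hB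
    · rw [(hB _).2]; simp
    · rw [(hB _).1, hi i (by omega)]; simp

/-- The quotient r = (q - a p) / X is the kernel polynomial, orthogonal with respect to p ↦ L(X p),
the functional that B induces on products of odd polynomials. Even powers of X are handled by parity
alone. -/
theorem isMonicOrthogonal_X_mul_comp_neg_sq (hB : ∀ p : ℝ[X], B (p.comp (-X ^ 2)) = c * L p)
    (hB' : ∀ p : ℝ[X], B (X * p.comp (-X ^ 2)) = 0) {n : ℕ} {p q r : ℝ[X]} {a : ℝ}
    (hp : IsMonicOrthogonal L n p) (hq : IsMonicOrthogonal L (n + 1) q)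
    (hr : X * r = q - C a * p) :
    IsMonicOrthogonal B (2 * n + 1) (X * (C ((-1) ^ n) * r.comp (-X ^ 2))) := by
  have hdeg : (C a * p).degree < q.degree := by
    rw [degree_eq_natDegree hq.monic.ne_zero, hq.natDegree_eq]
    refine degree_le_natDegree.trans_lt ?_
    have := natDegree_C_mul_le a p
    rw [hp.natDegree_eq] at this
    exact_mod_cast Nat.lt_succ_of_le this
  have hr1 : (X * r).Monic := hr ▸ hq.monic.sub_of_left hdeg
  have hrm : r.Monic := by
    rwa [Monic, leadingCoeff_mul, leadingCoeff_X, one_mul] at hr1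
  have hrn : r.natDegree = n := by
    have h := natDegree_X_mul hrm.ne_zero
    rw [hr, natDegree_eq_of_degree_eq (degree_sub_eq_left_of_degree_lt hdeg), hq.natDegree_eq] at h
    omega
  obtain ⟨h1, h2⟩ := monic_neg_one_pow_mul_comp_neg_sq hrm hrn
  refine ⟨monic_X.mul h1, by rw [natDegree_X_mul h1.ne_zero, h2],
    fun q' hq' => map_mul_eq_zero_of_forall_X_pow (fun k hk => ?_) hq'⟩
  have hi (i : ℕ) (hi : i < n) : L (X * (r * X ^ i)) = 0 := by
    have hd : ((X : ℝ[X]) ^ i).degree < n := by rw [degree_X_pow]; exact_mod_cast hi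
    rw [← mul_assoc, hr, sub_mul, map_sub, mul_assoc, ← smul_eq_C_mul, map_smul,
      hp.orthogonal _ hd, hq.orthogonal _ (hd.trans (by exact_mod_cast Nat.lt_succ_self n))]
    simp
  rw [mul_assoc, mul_assoc, mul_left_comm, ← smul_eq_C_mul, map_smul, smul_eq_mul]
  rcases Nat.even_or_odd' k with ⟨i, rfl | rfl⟩
  · rw [comp_neg_sq_mul_X_pow_two_mul, mul_left_comm, ← smul_eq_C_mul, map_smul, hB']
    simp
  · rw [pow_succ' X (2 * i), mul_left_comm (r.comp _) X,
      comp_neg_sq_mul_X_pow_two_mul, mul_left_comm X (C _), mul_left_comm X (C _), ← smul_eq_C_mul, map_smul,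
      map_X_sq_mul_comp_neg_sq hB, hi i (by omega)]
    simp

theorem not_isMonicOrthogonal_of_odd (hc : c ≠ 0) (hL : ∀ p : ℝ[X], p ≠ 0 → 0 < L (p * p))
    (hB : ∀ p : ℝ[X], B (X * p.comp (-X ^ 2)) = c * L p)
    (hB' : ∀ p : ℝ[X], B (p.comp (-X ^ 2)) = 0) (n : ℕ) (p : ℝ[X]) :
    ¬ IsMonicOrthogonal B (2 * n + 1) p := by
  intro hp
  have hn := hp.natDegree_eq
  obtain ⟨P, rfl⟩ := eq_comp_neg_sq_of_orthogonal_of_odd (D := p) (N := 2 * n + 1) hc hL hB hB'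
    (degree_le_natDegree.trans_lt (by rw [hn]; exact_mod_cast Nat.lt_succ_self _))
    fun k hk => hp.orthogonal _ (by rw [degree_X_pow]; exact_mod_cast hk)
  rw [natDegree_comp_neg_sq] at hn
  omega

theorem isMonicOrthogonal_unique_of_forall_eq_zero {N : ℕ}
    (h : ∀ D : ℝ[X], D.degree < N → (∀ k < N, B (D * X ^ k) = 0) → D = 0) {p q : ℝ[X]}
    (hp : IsMonicOrthogonal B N p) (hq : IsMonicOrthogonal B N q) : p = q := by
  refine sub_eq_zero.1 (h _
    (degree_sub_lt_of_monic hp.monic hq.monic hp.natDegree_eq hq.natDegree_eq) fun k hk => ?_)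
  have hd : ((X : ℝ[X]) ^ k).degree < N := by rw [degree_X_pow]; exact_mod_cast hk
  rw [sub_mul, map_sub, hp.orthogonal _ hd, hq.orthogonal _ hd, sub_zero]

end Functional

/-! ### The Prudnikov functional -/

section Prudnikov

variable {μ ν : ℝ} {m : ℕ}

theorem integrableOn_and_integral_prudnikovWeight_mul_eval (hμν : -1 < μ + ν) (hm : μ - ν = m)
    (p : ℝ[X]) : IntegrableOn (fun x => prudnikovWeight μ ν x * p.eval x) (Set.Ioi 0) ∧
      ∫ x in Set.Ioi (0 : ℝ), prudnikovWeight μ ν x * p.eval x =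
        momentFunctional (prudnikovMoment μ ν) p := by
  induction p using Polynomial.induction_on' with
  | add p q hp hq =>
    simp only [eval_add, mul_add, map_add]
    exact ⟨hp.1.add hq.1, by rw [integral_add hp.1 hq.1, hp.2, hq.2]⟩
  | monomial i a =>
    simp only [eval_monomial, momentFunctional_monomial, mul_left_comm _ a]
    exact ⟨(integrableOn_prudnikovWeight_mul_pow hμν hm i).const_mul a, by
      rw [integral_const_mul, mul_comm, prudnikovMoment]⟩

/-- The weight is positive and p has finitely many roots, so the integrand is positive off a null
set. -/
theorem momentFunctional_prudnikovMoment_pos (hμν : -1 < μ + ν) (hm : μ - ν = m) {p : ℝ[X]}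
    (hp : p ≠ 0) (hnn : ∀ x, 0 < x → 0 ≤ p.eval x) :
    0 < momentFunctional (prudnikovMoment μ ν) p := by
  obtain ⟨h1, h2⟩ := integrableOn_and_integral_prudnikovWeight_mul_eval hμν hm p
  rw [← h2, setIntegral_pos_iff_support_of_nonneg_ae _ h1]
  · have hsub : Set.Ioi (0 : ℝ) \ p.rootSet ℝ ⊆
        Function.support (fun x => prudnikovWeight μ ν x * p.eval x) ∩ Set.Ioi 0 := by
      rintro x ⟨hx, hxp⟩
      refine ⟨mul_ne_zero (prudnikovWeight_pos hm hx).ne' fun h => hxp ?_, hx⟩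
      rw [mem_rootSet_of_ne hp]
      simpa using h
    refine lt_of_lt_of_le ?_ (measure_mono hsub)
    rw [measure_sdiff_null ((p.rootSet_finite ℝ).measure_zero volume)]
    simp
  · filter_upwards [ae_restrict_mem measurableSet_Ioi] with x hx
    exact mul_nonneg (prudnikovWeight_pos hm hx).le (hnn x hx)

theorem momentFunctional_prudnikovMoment_mul_self_pos (hμν : -1 < μ + ν) (hm : μ - ν = m)
    (p : ℝ[X]) (hp : p ≠ 0) : 0 < momentFunctional (prudnikovMoment μ ν) (p * p) :=
  momentFunctional_prudnikovMoment_pos hμν hm (mul_ne_zero hp hp) fun x _ => by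
    rw [eval_mul]
    exact mul_self_nonneg _

theorem momentFunctional_prudnikovMoment_X_mul_pos (hμν : -1 < μ + ν) (hm : μ - ν = m)
    (p : ℝ[X]) (hp : p ≠ 0) : 0 < momentFunctional (prudnikovMoment μ ν) (X * (p * p)) :=
  momentFunctional_prudnikovMoment_pos hμν hm (mul_ne_zero X_ne_zero (mul_ne_zero hp hp))
    fun x hx => by
      rw [eval_mul, eval_mul, eval_X]
      exact mul_nonneg hx.le (mul_self_nonneg _)

theorem isMonicOrthogonalSeq_prudnikovWeight_iff (hμν : -1 < μ + ν) (hm : μ - ν = m)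
    (φ : ℕ → ℝ[X]) : IsMonicOrthogonalSeq (prudnikovWeight μ ν) φ ↔
      ∀ n, IsMonicOrthogonal (momentFunctional (prudnikovMoment μ ν)) n (φ n) := by
  have hint (n k : ℕ) := integrableOn_and_integral_prudnikovWeight_mul_eval hμν hm (φ n * φ k)
  simp only [eval_mul, ← mul_assoc] at hint
  constructor
  · intro h n
    refine ⟨h.monic n, h.natDegree_eq n, fun q hq => ?_⟩
    -- The members of index below n span all polynomials of degree < n, so pairwise orthogonality
    -- suffices.
    set S : Polynomial.Sequence ℝ := ⟨φ, fun i => by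
      rw [degree_eq_natDegree (h.monic i).ne_zero, h.natDegree_eq]⟩ with hS
    rw [← mem_degreeLT, ← S.span_degreeLT fun i _ => by
      rw [show S i = φ i from rfl, (h.monic i).leadingCoeff]; exact isUnit_one] at hq
    induction hq using Submodule.span_induction with
    | mem x hx =>
      obtain ⟨k, hk, rfl⟩ := hx
      rw [show S k = φ k from rfl, ← (hint n k).2]
      exact h.orthogonal n k (ne_of_gt hk)
    | zero => simp
    | add x y _ _ hx hy => rw [mul_add, map_add, hx, hy, add_zero]
    | smul a x _ hx => rw [mul_smul_comm, map_smul, hx, smul_zero]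
  · intro h
    refine ⟨fun n => (h n).monic, fun n => (h n).natDegree_eq, fun n k => (hint n k).1,
      fun n k hnk => ?_⟩
    rw [(hint n k).2]
    have hdeg (i : ℕ) : (φ i).degree = i := by
      rw [degree_eq_natDegree (h i).monic.ne_zero, (h i).natDegree_eq]
    rcases hnk.lt_or_gt with hlt | hlt
    · rw [mul_comm]
      exact (h k).orthogonal _ (by rw [hdeg]; exact_mod_cast hlt)
    · exact (h n).orthogonal _ (by rw [hdeg]; exact_mod_cast hlt)

end Prudnikov

/-! ### The Bessel functional -/

theorem momentFunctional_mul_X_pow (c : ℕ → ℝ) {p : ℝ[X]} {N : ℕ} (hp : p.natDegree < N) (k : ℕ) :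
    momentFunctional c (p * X ^ k) = ∑ j ∈ Finset.range N, p.coeff j * c (j + k) := by
  conv_lhs => rw [as_sum_range' p N hp]
  rw [Finset.sum_mul, map_sum]
  refine Finset.sum_congr rfl fun j _ => ?_
  rw [monomial_mul_X_pow, momentFunctional_monomial, mul_comm]

/-- The functional whose moments are the Abel integrals of `x ^ (j + m + ν) J_ν(x)`. -/
noncomputable def besselFunctional (ν : ℝ) (m : ℕ) : ℝ[X] →ₗ[ℝ] ℝ :=
  momentFunctional fun j => besselAbelMoment ν (m + j)

theorem besselFunctional_comp_neg_sq_mul_X_pow (ν : ℝ) (m r : ℕ) {d : ℕ → ℝ} {c : ℝ}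
    (h : ∀ i : ℕ, besselAbelMoment ν (m + (2 * i + r)) = c * ((-1) ^ i * d i)) (p : ℝ[X]) :
    besselFunctional ν m (X ^ r * p.comp (-X ^ 2)) = c * momentFunctional d p := by
  induction p using Polynomial.induction_on' with
  | add p q hp hq => rw [add_comp, mul_add, map_add, hp, hq, map_add, mul_add]
  | monomial i a =>
    have e : X ^ r * (monomial i a).comp (-X ^ 2) = monomial (2 * i + r) ((-1) ^ i * a) := by
      rw [monomial_comp, neg_pow (X ^ 2 : ℝ[X]) i, ← C_mul_X_pow_eq_monomial, C_mul, C_pow, C_neg,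
        C_1, pow_add, pow_mul]
      ring
    rw [e, besselFunctional, momentFunctional_monomial, momentFunctional_monomial, h]
    have : ((-1 : ℝ) ^ i) * (-1) ^ i = 1 := by rw [← mul_pow]; simp
    linear_combination c * d i * a * this

section Bessel

variable {μ ν : ℝ} {m : ℕ}

theorem besselFunctional_of_even (hμν : -1 < μ + ν) (hm : μ - ν = m) (he : Even m) :
    ∃ c, c ≠ 0 ∧ ∀ p : ℝ[X],
      besselFunctional ν m (p.comp (-X ^ 2)) = c * momentFunctional (prudnikovMoment μ ν) p ∧
      besselFunctional ν m (X * p.comp (-X ^ 2)) = 0 := by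
  obtain ⟨c, hc, h⟩ := besselAbelMoment_eq_prudnikovMoment hμν hm
  rw [Nat.even_iff.1 he] at h
  refine ⟨c, hc, fun p => ⟨?_, ?_⟩⟩
  · simpa using besselFunctional_comp_neg_sq_mul_X_pow ν m 0 h p
  -- The vanishing of the moments of the other parity is the same lemma with zero moments and c = 0.
  · have := besselFunctional_comp_neg_sq_mul_X_pow ν m 1 (d := fun _ => 0) (c := 0) (fun i => by
      rw [zero_mul]
      refine besselAbelMoment_eq_zero ?_ (by grind)
      have : (0 : ℝ) ≤ i := Nat.cast_nonneg _
      push_cast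
      linarith) p
    simpa using this

theorem besselFunctional_of_odd (hμν : -1 < μ + ν) (hm : μ - ν = m) (ho : Odd m) :
    ∃ c, c ≠ 0 ∧ ∀ p : ℝ[X],
      besselFunctional ν m (X * p.comp (-X ^ 2)) =
        c * momentFunctional (prudnikovMoment μ ν) p ∧
      besselFunctional ν m (p.comp (-X ^ 2)) = 0 := by
  obtain ⟨c, hc, h⟩ := besselAbelMoment_eq_prudnikovMoment hμν hm
  rw [Nat.odd_iff.1 ho] at h
  refine ⟨c, hc, fun p => ⟨?_, ?_⟩⟩
  · simpa using besselFunctional_comp_neg_sq_mul_X_pow ν m 1 h p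
  · have := besselFunctional_comp_neg_sq_mul_X_pow ν m 0 (d := fun _ => 0) (c := 0) (fun i => by
      rw [zero_mul]
      refine besselAbelMoment_eq_zero ?_ (by grind)
      have : (0 : ℝ) ≤ i := Nat.cast_nonneg _
      push_cast
      linarith) p
    simpa using this

/-- All these Abel integrals converge, so orthogonality becomes a linear system with real
coefficients for the coefficients of P. -/
theorem hasAbelIntegral_eval_mul_besselJ (hμν : -1 < μ + ν) (hm : μ - ν = m) (P : ℂ[X]) (k : ℕ) :
    HasAbelIntegral (fun x => P.eval (x : ℂ) * ((x ^ ((k : ℝ) + μ) * besselJ ν x : ℝ) : ℂ))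
      (∑ j ∈ Finset.range (P.natDegree + 1),
        P.coeff j * (besselAbelMoment ν (m + (j + k)) : ℂ)) := by
  have hν (j : ℕ) : -1 < 2 * ν + (m + (j + k) : ℕ) := by
    have h1 : (0 : ℝ) ≤ j := Nat.cast_nonneg _
    have h2 : (0 : ℝ) ≤ k := Nat.cast_nonneg _
    push_cast
    linarith
  have hfun (s : ℝ) : Set.EqOn
      (fun x : ℝ => ∑ j ∈ Finset.range (P.natDegree + 1), P.coeff j *
        ((x ^ (ν + (m + (j + k) : ℕ)) * besselJ ν x * Real.exp (-s * x) : ℝ) : ℂ))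
      (fun x : ℝ => P.eval (x : ℂ) * ((x ^ ((k : ℝ) + μ) * besselJ ν x : ℝ) : ℂ) *
        (Real.exp (-s * x) : ℂ)) (Set.Ioi 0) := by
    intro x hx
    have hx : 0 < x := hx
    simp only
    rw [eval_eq_sum_range, Finset.sum_mul, Finset.sum_mul]
    refine Finset.sum_congr rfl fun j _ => ?_
    rw [show ν + ((m + (j + k) : ℕ) : ℝ) = j + (k + μ) by push_cast; linarith, Real.rpow_add hx,
      Real.rpow_natCast]
    push_cast
    ring
  have hint (s : ℝ) (hs : 0 < s) (j : ℕ) : IntegrableOn (fun x : ℝ => P.coeff j *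
      ((x ^ (ν + (m + (j + k) : ℕ)) * besselJ ν x * Real.exp (-s * x) : ℝ) : ℂ)) (Set.Ioi 0) := by
    refine Integrable.const_mul (Integrable.ofReal
      (integrableOn_besselLaplace (ν := ν) ?_ hs)) _
    have := hν j
    linarith
  refine ⟨fun s hs => IntegrableOn.congr_fun
    (integrable_finsetSum _ fun j _ => hint s hs j) (hfun s) measurableSet_Ioi, ?_⟩
  have hlim : Tendsto (fun s : ℝ => ∑ j ∈ Finset.range (P.natDegree + 1),
      P.coeff j * (besselLaplace ν (ν + (m + (j + k) : ℕ)) s : ℂ)) (𝓝[>] 0)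
      (𝓝 (∑ j ∈ Finset.range (P.natDegree + 1),
        P.coeff j * (besselAbelMoment ν (m + (j + k)) : ℂ))) :=
    tendsto_finsetSum _ fun j _ => Tendsto.const_mul _
      ((Complex.continuous_ofReal.tendsto _).comp (tendsto_besselLaplace (hν j)))
  refine hlim.congr' ?_
  filter_upwards [self_mem_nhdsWithin] with s hs
  rw [← setIntegral_congr_fun measurableSet_Ioi (hfun s),
    integral_finsetSum _ fun j _ => hint s hs j]
  refine Finset.sum_congr rfl fun j _ => ?_
  rw [integral_const_mul, integral_complex_ofReal, besselLaplace]

theorem isBesselOrthogonal_iff (hμν : -1 < μ + ν) (hm : μ - ν = m) (N : ℕ) (P : ℂ[X]) :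
    IsBesselOrthogonal μ ν N P ↔ P.Monic ∧ P.natDegree = N ∧ ∀ k < N,
      ∑ j ∈ Finset.range (N + 1), P.coeff j * (besselAbelMoment ν (m + (j + k)) : ℂ) = 0 := by
  have h (k : ℕ) := hasAbelIntegral_eval_mul_besselJ hμν hm P k
  constructor
  · rintro ⟨h1, h2, h3⟩
    refine ⟨h1, h2, fun k hk => ?_⟩
    rw [← h2]
    exact tendsto_nhds_unique (h k).2 (h3 k hk).2
  · rintro ⟨h1, h2, h3⟩
    refine ⟨h1, h2, fun k hk => ?_⟩
    rw [← h3 k hk, ← h2]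
    exact h k

theorem IsMonicOrthogonal.isBesselOrthogonal_map (hμν : -1 < μ + ν) (hm : μ - ν = m) {N : ℕ}
    {p : ℝ[X]} (hp : IsMonicOrthogonal (besselFunctional ν m) N p) :
    IsBesselOrthogonal μ ν N (p.map Complex.ofRealHom) := by
  refine (isBesselOrthogonal_iff hμν hm N _).2 ⟨hp.monic.map _, ?_, fun k hk => ?_⟩
  · rw [hp.monic.natDegree_map, hp.natDegree_eq]
  · have h := hp.orthogonal (X ^ k) (by rw [degree_X_pow]; exact_mod_cast hk)
    rw [besselFunctional, momentFunctional_mul_X_pow _ (N := N + 1) (by rw [hp.natDegree_eq]; simp)]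
      at h
    simp only [coeff_map, Complex.ofRealHom_eq_coe]
    exact_mod_cast congrArg Complex.ofReal h

/-- The real polynomial obtained by applying a real linear map to the coefficients of a complex
polynomial. -/
noncomputable def mapCoeffReal (f : ℂ →ₗ[ℝ] ℝ) (P : ℂ[X]) : ℝ[X] :=
  ∑ j ∈ Finset.range (P.natDegree + 1), monomial j (f (P.coeff j))

theorem coeff_mapCoeffReal (f : ℂ →ₗ[ℝ] ℝ) (P : ℂ[X]) (j : ℕ) :
    (mapCoeffReal f P).coeff j = f (P.coeff j) := by
  rw [mapCoeffReal, finsetSum_coeff]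
  simp only [coeff_monomial, Finset.sum_ite_eq', Finset.mem_range]
  split_ifs with h
  · rfl
  · rw [coeff_eq_zero_of_natDegree_lt (by omega), map_zero]

/-- The linear system is real, so any real-linear f may be applied to it; f 1 = 1 keeps the
polynomial monic. -/
theorem IsBesselOrthogonal.isMonicOrthogonal_mapCoeffReal (hμν : -1 < μ + ν) (hm : μ - ν = m)
    {N : ℕ} {P : ℂ[X]} (hP : IsBesselOrthogonal μ ν N P) {f : ℂ →ₗ[ℝ] ℝ} (hf : f 1 = 1) :
    IsMonicOrthogonal (besselFunctional ν m) N (mapCoeffReal f P) := by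
  obtain ⟨h1, h2, h3⟩ := (isBesselOrthogonal_iff hμν hm N P).1 hP
  have hN : (mapCoeffReal f P).coeff N = 1 := by
    rw [coeff_mapCoeffReal, ← h2, h1.coeff_natDegree, hf]
  have hle : (mapCoeffReal f P).natDegree ≤ N := natDegree_le_iff_coeff_eq_zero.2 fun j hj => by
    rw [coeff_mapCoeffReal, coeff_eq_zero_of_natDegree_lt (by omega), map_zero]
  have hmonic := monic_of_natDegree_le_of_coeff_eq_one N hle hN
  refine ⟨hmonic, le_antisymm hle (le_natDegree_of_ne_zero (by rw [hN]; exact one_ne_zero)),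
    fun q hq => map_mul_eq_zero_of_forall_X_pow (fun k hk => ?_) hq⟩
  rw [besselFunctional, momentFunctional_mul_X_pow _ (Nat.lt_succ_of_le hle)]
  have h := congrArg f (h3 k hk)
  rw [map_sum, map_zero] at h
  rw [← h]
  refine Finset.sum_congr rfl fun j _ => ?_
  rw [coeff_mapCoeffReal, mul_comm (P.coeff j), ← Complex.real_smul, map_smul, smul_eq_mul,
    mul_comm]

theorem IsBesselOrthogonal.eq_map (hμν : -1 < μ + ν) (hm : μ - ν = m) {N : ℕ}
    (huniq : ∀ p q : ℝ[X], IsMonicOrthogonal (besselFunctional ν m) N p →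
      IsMonicOrthogonal (besselFunctional ν m) N q → p = q) {p : ℝ[X]}
    (hp : IsMonicOrthogonal (besselFunctional ν m) N p) {P : ℂ[X]}
    (hP : IsBesselOrthogonal μ ν N P) : P = p.map Complex.ofRealHom := by
  have h1 := huniq _ _ (hP.isMonicOrthogonal_mapCoeffReal hμν hm (f := Complex.reLm)
    Complex.one_re) hp
  -- The imaginary part alone sends 1 to 0 and would lose monicity. Since re and re + im both yield
  -- p, the imaginary parts vanish.
  have h2 := huniq _ _ (hP.isMonicOrthogonal_mapCoeffReal hμν hm
    (f := Complex.reLm + Complex.imLm) (by simp)) hp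
  ext j
  have e1 := congrArg (fun q => coeff q j) h1
  have e2 := congrArg (fun q => coeff q j) h2
  simp only [coeff_mapCoeffReal, LinearMap.add_apply, Complex.reLm_coe, Complex.imLm_coe] at e1 e2
  rw [coeff_map]
  apply Complex.ext
  · simpa using e1
  · simp only [Complex.ofRealHom_eq_coe, Complex.ofReal_im]
    linarith

theorem existsUnique_isBesselOrthogonal_and_eval_eq (hμν : -1 < μ + ν) (hm : μ - ν = m) {N : ℕ}
    (huniq : ∀ p q : ℝ[X], IsMonicOrthogonal (besselFunctional ν m) N p →
      IsMonicOrthogonal (besselFunctional ν m) N q → p = q) {p : ℝ[X]}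
    (hp : IsMonicOrthogonal (besselFunctional ν m) N p) :
    (∃! P : ℂ[X], IsBesselOrthogonal μ ν N P) ∧
      ∀ P : ℂ[X], IsBesselOrthogonal μ ν N P → ∀ x : ℂ, P.eval x = aeval x p := by
  refine ⟨⟨_, hp.isBesselOrthogonal_map hμν hm, fun P hP => hP.eq_map hμν hm huniq hp⟩,
    fun P hP x => ?_⟩
  rw [hP.eq_map hμν hm huniq hp, eval_map, aeval_def]
  rfl

end Bessel

/-! ### The main theorem. -/

theorem mainTheorem4 (μ ν : ℝ) (m : ℕ) (hμν : -1 < μ + ν) (hm : μ - ν = (m : ℝ)) :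
    (∃! φ : ℕ → ℝ[X], IsMonicOrthogonalSeq (prudnikovWeight μ ν) φ) ∧
    ∀ φ : ℕ → ℝ[X], IsMonicOrthogonalSeq (prudnikovWeight μ ν) φ →
      (∀ n : ℕ,
        (∃! P : ℂ[X], IsBesselOrthogonal μ ν (2 * n) P) ∧
        ∀ P : ℂ[X], IsBesselOrthogonal μ ν (2 * n) P →
          ∀ x : ℂ, P.eval x = (-1) ^ n * aeval (-x ^ 2) (φ n)) ∧
      (Even m → ∀ n : ℕ,
        (φ n).eval 0 ≠ 0 ∧
        (∃! P : ℂ[X], IsBesselOrthogonal μ ν (2 * n + 1) P) ∧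
        ∀ P : ℂ[X], IsBesselOrthogonal μ ν (2 * n + 1) P →
          ∀ x : ℂ, x ≠ 0 → P.eval x =
            (-1) ^ (n + 1) / x * (aeval (-x ^ 2) (φ (n + 1)) -
              (((φ (n + 1)).eval 0 / (φ n).eval 0 : ℝ) : ℂ) * aeval (-x ^ 2) (φ n))) ∧
      (Odd m → ∀ n : ℕ, ¬ ∃ P : ℂ[X], IsBesselOrthogonal μ ν (2 * n + 1) P) := by
  have hL := momentFunctional_prudnikovMoment_mul_self_pos hμν hm
  have hX := momentFunctional_prudnikovMoment_X_mul_pos hμν hm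
  refine ⟨?_, fun φ hφ => ?_⟩
  · choose φ hφ using exists_isMonicOrthogonal hL
    refine ⟨φ, (isMonicOrthogonalSeq_prudnikovWeight_iff hμν hm φ).2 hφ, fun ψ hψ => ?_⟩
    replace hψ := (isMonicOrthogonalSeq_prudnikovWeight_iff hμν hm ψ).1 hψ
    exact funext fun n => (hψ n).unique hL (hφ n)
  rw [isMonicOrthogonalSeq_prudnikovWeight_iff hμν hm] at hφ
  refine ⟨fun n => ?_, fun he n => ?_, fun ho n => ?_⟩
  · have key : (∀ p q : ℝ[X], IsMonicOrthogonal (besselFunctional ν m) (2 * n) p →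
        IsMonicOrthogonal (besselFunctional ν m) (2 * n) q → p = q) ∧
        IsMonicOrthogonal (besselFunctional ν m) (2 * n)
          (C ((-1) ^ n) * (φ n).comp (-X ^ 2)) := by
      rcases Nat.even_or_odd m with he | ho
      · obtain ⟨c, hc, hB⟩ := besselFunctional_of_even hμν hm he
        exact ⟨fun p q => isMonicOrthogonal_unique_of_forall_eq_zero fun D =>
          eq_zero_of_orthogonal_of_even hc hL hX (fun p => (hB p).1) (fun p => (hB p).2),
          isMonicOrthogonal_comp_neg_sq (Or.inl hB) (hφ n)⟩
      · obtain ⟨c, hc, hB⟩ := besselFunctional_of_odd hμν hm ho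
        exact ⟨fun p q => isMonicOrthogonal_unique_of_forall_eq_zero fun D =>
          eq_zero_of_orthogonal_of_odd hc hL (fun p => (hB p).1) (fun p => (hB p).2),
          isMonicOrthogonal_comp_neg_sq (Or.inr hB) (hφ n)⟩
    obtain ⟨h1, h2⟩ := existsUnique_isBesselOrthogonal_and_eval_eq hμν hm key.1 key.2
    refine ⟨h1, fun P hP x => ?_⟩
    rw [h2 P hP x]
    simp [aeval_comp]
  · obtain ⟨c, hc, hB⟩ := besselFunctional_of_even hμν hm he
    have h0 := (hφ n).eval_zero_ne_zero hX
    set a := (φ (n + 1)).eval 0 / (φ n).eval 0 with ha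
    -- The constant a is chosen so that the difference vanishes at 0.
    obtain ⟨r, hr⟩ : X ∣ φ (n + 1) - C a * φ n := by
      rw [X_dvd_iff, coeff_zero_eq_eval_zero, eval_sub, eval_mul, eval_C, ha,
        div_mul_cancel₀ _ h0, sub_self]
    have key := isMonicOrthogonal_X_mul_comp_neg_sq (fun p => (hB p).1) (fun p => (hB p).2)
      (hφ n) (hφ (n + 1)) hr.symm
    obtain ⟨h1, h2⟩ := existsUnique_isBesselOrthogonal_and_eval_eq hμν hm
      (fun p q => isMonicOrthogonal_unique_of_forall_eq_zero fun D =>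
        eq_zero_of_orthogonal_of_even hc hL hX (fun p => (hB p).1) (fun p => (hB p).2)) key
    refine ⟨h0, h1, fun P hP x hx => ?_⟩
    -- At -x² the factor X of X r becomes -x²; dividing by it turns (-1)^n x into (-1)^(n+1) / x.
    have e := congrArg (aeval (-x ^ 2)) hr
    simp only [map_sub, map_mul, aeval_C, aeval_X, Complex.coe_algebraMap] at e
    rw [h2 P hP x, e]
    simp only [map_mul, aeval_X, aeval_comp, map_neg, map_pow, map_one]
    field_simp
    ring
  · rintro ⟨P, hP⟩
    obtain ⟨c, hc, hB⟩ := besselFunctional_of_odd hμν hm ho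
    exact not_isMonicOrthogonal_of_odd hc hL (fun p => (hB p).1) (fun p => (hB p).2) n _
      (hP.isMonicOrthogonal_mapCoeffReal hμν hm (f := Complex.reLm) Complex.one_re)
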